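/- Let $d\ge 0$ and $b\ge 1$ be integers, let $(x,y)$ be a random pair in $\mathbb{R}^d\times\mathbb{R}$ with $\mathbb{E}\|x\|_2^4<\infty$ and $\mathbb{E}[y^2]<\infty$, and let $$f(\theta)=\tfrac12\,\mathbb{E}\big[(x^T\theta-y)^2\big],\qquad \Sigma=\mathbb{E}[xx^T],\qquad \theta_*=\Sigma^{\dagger}\,\mathbb{E}[yx],\qquad \epsilon=y-x^T\theta_*,$$ where $\Sigma^\dagger$ is the Moore–Penrose inverse. Assume that $\mathbb{E}[\epsilon^2\|x\|_2^2]<\infty$ and that, for real numbers $R,\sigma,\lambda$ and in the Loewner order, $$\mathbb{E}\big[\|x\|_2^2\,xx^T\big]\preceq R^2\Sigma,\qquad \mathbb{E}\big[\epsilon^2xx^T\big]\preceq\sigma^2\Sigma,\qquad \Sigma\preceq\lambda I .$$ Let the learning rate satisfy $\eta>0$ and $\eta\,\dfrac{R^2+(b-1)\lambda}{b}<2$, and let $\theta_0\in\mathbb{R}^d$. Consider two algorithms started at $\theta_0$. In each step they draw a fresh mini-batch of i.i.d. copies $(x_r,y_r)$ of $(x,y)$, independent of the previous steps. * Small-batch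 SGD, with batches $b_n$ of size $b$: $\ \theta_{n+1}=\theta_n-\dfrac{\eta}{b}\sum_{r\in b_n}\big(x_rx_r^T\theta_n-y_rx_r\big)$. * Large-batch MSGD, with batches $B_n$ of size $B>b$: $\ \theta_{n+1}=\theta_n-\eta\sum_{r\in B_n}w_r\big(x_rx_r^T\theta_n-y_rx_r\big)$, where the sampling vectors $\mathcal{W}=(w_r)_{r\in B_n}\in\mathbb{R}^B$ of the different steps are square integrable, independent of each other and of all the data, and satisfy $$\mathbb{E}[\mathcal{W}]=\tfrac1B\mathbb{1},\qquad \mathrm{Var}[\mathcal{W}]=\frac{B-b}{bB(B-1)}\Big(I-\tfrac1B\mathbb{1}\mathbb{1}^T\Big).$$ Let $\bar\theta_n=\frac1{n+1}\sum_{i=0}^n\theta_i$. Then for both algorithms and every $n\ge 0$, $f(\bar\theta_n)$ is integrable and $$\mathbb{E}\,f(\bar\theta_n)-f(\theta_*)\le\frac{C_1}{n+1}+\frac{C_2}{(n+1)^2},$$ with the same constants for both. Here $C_1$ depends only on $d,b,\eta,R,\sigma,\lambda$, and $C_2$ depends only on these and on the number $(\theta_0-\theta_*)^T\Sigma^\dagger(\theta_0-\theta_*)$.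 In particular neither depends on $B$, on $n$, or on the distribution of $\mathcal{W}$ beyond its mean and covariance. -/

import Mathlib

open MeasureTheory ProbabilityTheory

noncomputable section

namespace OnlineLS

/-- The parameter and feature space `ℝ^d` with its Euclidean norm. -/
abbrev Vec (d : ℕ) := EuclideanSpace ℝ (Fin d)

/-! ### The least-squares problem

A law `ν` on `Vec d × ℝ` is the joint law of a feature vector and a response `(x, y)`. -/

/-- `f(θ) = ½ E[(xᵀθ - y)²]`. -/
def risk {d : ℕ} (ν : Measure (Vec d × ℝ)) (θ : Vec d) : ℝ :=
  (1 / 2) * ∫ p, (inner ℝ p.1 θ - p.2) ^ 2 ∂ν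

/-- `Σ = E[x xᵀ]`. -/
def secondMoment {d : ℕ} (ν : Measure (Vec d × ℝ)) : Matrix (Fin d) (Fin d) ℝ :=
  Matrix.of fun i j => ∫ p, p.1 i * p.1 j ∂ν

theorem secondMoment_isHermitian {d : ℕ} (ν : Measure (Vec d × ℝ)) :
    (secondMoment ν).IsHermitian := by
  ext i j
  simp [secondMoment, mul_comm]

/-- The Moore-Penrose inverse `A†` of a symmetric real matrix: every nonzero eigenvalue is inverted
and the kernel is kept (`0⁻¹ = 0`). -/
def pinv {d : ℕ} {A : Matrix (Fin d) (Fin d) ℝ} (hA : A.IsHermitian) :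
    Matrix (Fin d) (Fin d) ℝ :=
  hA.cfc fun t => t⁻¹

/-- The four Penrose conditions, which characterize the Moore-Penrose inverse. -/
theorem pinv_spec {d : ℕ} {A : Matrix (Fin d) (Fin d) ℝ} (hA : A.IsHermitian) :
    A * pinv hA * A = A ∧ pinv hA * A * pinv hA = pinv hA ∧
      (A * pinv hA).IsHermitian ∧ (pinv hA * A).IsHermitian := by
  have hm : ∀ f g : ℝ → ℝ, hA.cfc f * hA.cfc g = hA.cfc fun t => f t * g t := by
    intro f g
    simp only [Matrix.IsHermitian.cfc, ← map_mul, Matrix.diagonal_mul_diagonal]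
    rfl
  have hs : ∀ f : ℝ → ℝ, (hA.cfc f).IsHermitian := by
    intro f
    rw [Matrix.IsHermitian, ← Matrix.star_eq_conjTranspose, Matrix.IsHermitian.cfc, ← map_star]
    congr 1
    rw [Matrix.star_eq_conjTranspose, Matrix.diagonal_conjTranspose]
    congr 1
  have ha : A = hA.cfc (fun t => t) := hA.spectral_theorem
  have h1 : A * pinv hA = hA.cfc fun t => t * t⁻¹ :=
    (congrArg (· * pinv hA) ha).trans (hm _ _)
  have h2 : pinv hA * A = hA.cfc fun t => t⁻¹ * t :=
    (congrArg (pinv hA * ·) ha).trans (hm _ _)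
  refine ⟨?_, ?_, h1 ▸ hs _, h2 ▸ hs _⟩
  · rw [h1]
    refine ((congrArg (hA.cfc (fun t => t * t⁻¹) * ·) ha).trans (hm _ _)).trans ?_
    simp only [mul_inv_mul_cancel]
    exact ha.symm
  · rw [h2]
    refine (hm _ _).trans ?_
    simp only [pinv]
    congr 1
    funext t
    by_cases h : t = 0 <;> simp [h]

/-- `E[y x]`. -/
def crossMoment {d : ℕ} (ν : Measure (Vec d × ℝ)) : Vec d :=
  WithLp.toLp 2 fun i => ∫ p, p.2 * p.1 i ∂ν

/-- The optimum `θ_* = Σ† E[y x]`. -/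
def optimum {d : ℕ} (ν : Measure (Vec d × ℝ)) : Vec d :=
  WithLp.toLp 2 ((pinv (secondMoment_isHermitian ν)).mulVec (crossMoment ν).ofLp)

/-- The residual `ε = y - xᵀ θ_*`. -/
def residual {d : ℕ} (ν : Measure (Vec d × ℝ)) (p : Vec d × ℝ) : ℝ :=
  p.2 - inner ℝ p.1 (optimum ν)

/-- `(θ - θ_*)ᵀ Σ† (θ - θ_*)`. -/
def initialGap {d : ℕ} (ν : Measure (Vec d × ℝ)) (θ : Vec d) : ℝ :=
  (θ - optimum ν).ofLp ⬝ᵥ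
    (pinv (secondMoment_isHermitian ν)).mulVec (θ - optimum ν).ofLp

/-- `E[‖x‖² x xᵀ]`. -/
def fourthMoment {d : ℕ} (ν : Measure (Vec d × ℝ)) : Matrix (Fin d) (Fin d) ℝ :=
  Matrix.of fun i j => ∫ p, ‖p.1‖ ^ 2 * (p.1 i * p.1 j) ∂ν

/-- `E[ε² x xᵀ]`. -/
def noiseMoment {d : ℕ} (ν : Measure (Vec d × ℝ)) : Matrix (Fin d) (Fin d) ℝ :=
  Matrix.of fun i j => ∫ p, residual ν p ^ 2 * (p.1 i * p.1 j) ∂ν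

/-- The standing assumptions on the data law: the moments that occur are finite, and
`E[‖x‖² x xᵀ] ⪯ R² Σ`, `E[ε² x xᵀ] ⪯ σ² Σ`, `Σ ⪯ lam I` in the Loewner order. -/
structure Assumptions {d : ℕ} (ν : Measure (Vec d × ℝ)) (R σ lam : ℝ) : Prop where
  memLp_fst : MemLp (fun p : Vec d × ℝ => p.1) 4 ν
  memLp_snd : MemLp (fun p : Vec d × ℝ => p.2) 2 ν
  integrable_noise : Integrable (fun p : Vec d × ℝ => residual ν p ^ 2 * ‖p.1‖ ^ 2) ν
  fourthMoment_le : (R ^ 2 • secondMoment ν - fourthMoment ν).PosSemidef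
  noiseMoment_le : (σ ^ 2 • secondMoment ν - noiseMoment ν).PosSemidef
  secondMoment_le : (lam • (1 : Matrix (Fin d) (Fin d) ℝ) - secondMoment ν).PosSemidef

/-! ### The algorithms

`z n r` is the `r`-th sample `(x, y)` of the mini-batch used in step `n`. -/

/-- The gradient `x xᵀ θ - y x` of the loss `½ (xᵀθ - y)²` of one sample `p = (x, y)`. -/
def sampleGrad {d : ℕ} (p : Vec d × ℝ) (θ : Vec d) : Vec d :=
  (inner ℝ p.1 θ - p.2) • p.1

/-- MSGD: `θ_{n+1} = θ_n - η ∑_r w_r (x_r x_rᵀ θ_n - y_r x_r)`, with sampling vector `w n` in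
step `n`. -/
def msgd {d B : ℕ} (η : ℝ) (θ₀ : Vec d) (z : ℕ → Fin B → Vec d × ℝ) (w : ℕ → Fin B → ℝ) :
    ℕ → Vec d
  | 0 => θ₀
  | n + 1 => msgd η θ₀ z w n - η • ∑ r, w n r • sampleGrad (z n r) (msgd η θ₀ z w n)

/-- Mini-batch SGD: `θ_{n+1} = θ_n - η (1/b) ∑_r (x_r x_rᵀ θ_n - y_r x_r)`. -/
def sgd {d b : ℕ} (η : ℝ) (θ₀ : Vec d) (z : ℕ → Fin b → Vec d × ℝ) : ℕ → Vec d
  | 0 => θ₀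
  | n + 1 => sgd η θ₀ z n - η • ((1 / (b : ℝ)) • ∑ r, sampleGrad (z n r) (sgd η θ₀ z n))

/-- The averaged iterate `(1/(n+1)) ∑_{i=0}^n θ_i`. -/
def average {d : ℕ} (θ : ℕ → Vec d) (n : ℕ) : Vec d :=
  (1 / ((n : ℝ) + 1)) • ∑ i ∈ Finset.range (n + 1), θ i

/-- Online mini-batches of size `B`: all samples, within a batch and over all steps, are
independent with law `ν`. -/
structure IsOnlineSample {d B : ℕ} {Ω : Type*} [MeasurableSpace Ω] (μ : Measure Ω)
    (ν : Measure (Vec d × ℝ)) (z : ℕ → Fin B → Ω → Vec d × ℝ) : Prop where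
  measurable : ∀ n r, Measurable (z n r)
  map_eq : ∀ n r, μ.map (z n r) = ν
  indep : iIndepFun (fun k : ℕ × Fin B => z k.1 k.2) μ

/-- Sampling vectors of the steps: independent over the steps, square integrable, with mean
`(1/B) 𝟙` and covariance matrix `(B-b)/(bB(B-1)) (I - (1/B) 𝟙𝟙ᵀ)`. -/
structure IsSampling {B : ℕ} {Ω : Type*} [MeasurableSpace Ω] (μ : Measure Ω) (b : ℕ)
    (w : ℕ → Ω → Fin B → ℝ) : Prop where
  measurable : ∀ n, Measurable (w n)
  memLp : ∀ n r, MemLp (fun ω => w n ω r) 2 μ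
  mean : ∀ n r, ∫ ω, w n ω r ∂μ = 1 / (B : ℝ)
  cov : ∀ n, (Matrix.of fun r s => covariance (fun ω => w n ω r) (fun ω => w n ω s) μ) =
    (((B : ℝ) - b) / (b * B * (B - 1))) •
      ((1 : Matrix (Fin B) (Fin B) ℝ) - (1 / (B : ℝ)) • Matrix.vecMulVec 1 1)
  indep : iIndepFun w μ

end OnlineLS

end

/-!
The two algorithms are compared through one abstract recursion. A batch sum `∑_r w_r g(x_r, y_r)`
has first and second moments that involve the weights only through `E ∑_r w_r² = 1/b` and
`E (∑_r w_r)² = 1` (`integral_batchSum_mul`). Both hold for the sampling vectors of large-batch MSGD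
and for the uniform weights `1/b` on a batch of size `b`, so mini-batch SGD is the case `B = b` and a
single rate (`msgd_rate`) covers both algorithms.

Write `H = ∑_r w_r x_r x_rᵀ`, `ρ = (R² + (b-1)λ)/b` and `γ = 2 - ηρ > 0`. The assumptions give
`E[H²] ⪯ ρ Σ`, hence one step `I - ηH` satisfies `E[(I - ηH)²] ⪯ I - ηγ Σ`
(`Assumptions.sum_stepMoment_le`). The error `u_n = θ_n - θ_*` is a sum of three parts:

* the component of `u_0` in the kernel of `Σ`, which is almost surely never moved and does not
  affect the risk;
* the process driven by the noise `∑_r w_r ε_r x_r` and started at zero. It has mean zero, so its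
  covariances obey a closed recursion, and `E[u_n u_nᵀ] ⪯ ησ²/(bγ) I` is preserved by it
  (`integral_inner_sq_noisy_le`);
* the noiseless process started in the range of `Σ`. There `u_0 u_0ᵀ ⪯ g Σ` with
  `g = u_0ᵀ Σ† u_0`, and `Σ` is at most `1/(ηγ)` times the decrease of `I` under one step, so that
  the covariances sum up to at most `g/(ηγ) I` (`sum_integral_inner_sq_noiseless_le`).

For each of the last two parts, `E[u_{n+1} | past] = (I - ηΣ) u_n` with a contraction `I - ηΣ`, and a
telescoping argument gives `E[sᵀ Σ s] ≤ (4/η) ∑_i E‖u_i‖²` for the sum `s` of the first errors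
(`integral_inner_covOp_sum_le`). The excess risk of the average is `½ sᵀ Σ s/(n+1)²`, which turns the
two covariance bounds into the terms of order `1/(n+1)` and `1/(n+1)²`.

Covariance matrices appear as the quadratic forms `v ↦ E⟨v, u⟩²`.
-/

noncomputable section

namespace OnlineLS

/-! ### Independence and square integrability -/

theorem integrable_mul_of_memLp_two {Ω : Type*} [MeasurableSpace Ω] {μ : Measure Ω} {X Y : Ω → ℝ}
    (hX : MemLp X 2 μ) (hY : MemLp Y 2 μ) : Integrable (fun ω => X ω * Y ω) μ :=
  hX.integrable_mul hY

theorem memLp_two_mul_of_indepFun {Ω : Type*} [MeasurableSpace Ω] {μ : Measure Ω} {X Y : Ω → ℝ}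
    (h : IndepFun X Y μ) (hX : MemLp X 2 μ) (hY : MemLp Y 2 μ) :
    MemLp (fun ω => X ω * Y ω) 2 μ := by
  refine (memLp_two_iff_integrable_sq (hX.aestronglyMeasurable.mul hY.aestronglyMeasurable)).2 ?_
  have hsq : Measurable fun t : ℝ => t ^ 2 := by fun_prop
  have := (h.comp hsq hsq).integrable_mul hX.integrable_sq hY.integrable_sq
  refine this.congr (Filter.Eventually.of_forall fun ω => ?_)
  simp [mul_pow]

theorem indepFun_of_indep {Ω α β : Type*} [MeasurableSpace α] [MeasurableSpace β]
    {m : MeasurableSpace Ω} {μ : Measure Ω} {F G : MeasurableSpace Ω} (h : Indep F G μ)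
    {X : Ω → α} {Y : Ω → β} (hX : Measurable[F] X) (hY : Measurable[G] Y) : IndepFun X Y μ := by
  rw [IndepFun_iff_Indep]
  exact indep_of_indep_of_le_left (indep_of_indep_of_le_right h hY.comap_le) hX.comap_le

/-- Two families of independent σ-algebras whose suprema are independent of each other form one
independent family. -/
theorem iIndep_sumElim {Ω ι κ : Type*} {m : MeasurableSpace Ω} {μ : Measure Ω}
    {F : ι → MeasurableSpace Ω} {G : κ → MeasurableSpace Ω}
    (hF : iIndep F μ) (hG : iIndep G μ) (h : Indep (⨆ i, F i) (⨆ k, G k) μ) :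
    iIndep (Sum.elim F G) μ := by
  classical
  rw [iIndep_iff]
  intro s f hf
  rw [iIndep_iff] at hF hG
  have h1 := hF s.toLeft (f := fun i => f (Sum.inl i)) fun i hi => hf _ (Finset.mem_toLeft.1 hi)
  have h2 := hG s.toRight (f := fun i => f (Sum.inr i)) fun i hi => hf _ (Finset.mem_toRight.1 hi)
  have hs : (⋂ i ∈ s, f i) =
      (⋂ i ∈ s.toLeft, f (Sum.inl i)) ∩ ⋂ i ∈ s.toRight, f (Sum.inr i) := by
    ext ω
    simp only [Set.mem_iInter, Set.mem_inter_iff, Finset.mem_toLeft, Finset.mem_toRight]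
    exact ⟨fun H => ⟨fun i hi => H _ hi, fun i hi => H _ hi⟩,
      fun H i hi => by cases i with
        | inl i => exact H.1 i hi
        | inr i => exact H.2 i hi⟩
  have hp : ∏ i ∈ s, μ (f i) =
      (∏ i ∈ s.toLeft, μ (f (Sum.inl i))) * ∏ i ∈ s.toRight, μ (f (Sum.inr i)) := by
    conv_lhs => rw [← Finset.toLeft_disjSum_toRight (u := s)]
    rw [Finset.prod_disjSum]
  rw [hs, hp, ← h1, ← h2]
  refine (Indep_iff _ _ μ).1 h _ _ ?_ ?_
  · exact Finset.measurableSet_biInter _ fun i hi =>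
      le_iSup F i _ (hf _ (Finset.mem_toLeft.1 hi))
  · exact Finset.measurableSet_biInter _ fun i hi =>
      le_iSup G i _ (hf _ (Finset.mem_toRight.1 hi))

/-! ### Moments of a weighted mini-batch -/

/-- The weighted batch sum `∑_r w_r g(x_r, y_r)` of a function `g` of one sample. -/
def batchSum {α : Type*} {B : ℕ} (w : Fin B → ℝ) (z : Fin B → α) (g : α → ℝ) : ℝ :=
  ∑ r, w r * g (z r)

section Moments

variable {d b B : ℕ} {Ω : Type*} [MeasurableSpace Ω] {μ : Measure Ω}
  {ν : Measure (Vec d × ℝ)} {z : ℕ → Fin B → Ω → Vec d × ℝ} {w : ℕ → Ω → Fin B → ℝ}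

variable (hz : IsOnlineSample μ ν z) (hw : IsSampling μ b w)
  (hzw : IndepFun (fun ω (k : ℕ × Fin B) => z k.1 k.2 ω) (fun ω n => w n ω) μ)

include hz in
theorem IsOnlineSample.integral_comp {g : Vec d × ℝ → ℝ} (hg : Measurable g) (n : ℕ) (r : Fin B) :
    ∫ ω, g (z n r ω) ∂μ = ∫ p, g p ∂ν := by
  rw [← hz.map_eq n r, integral_map (hz.measurable n r).aemeasurable hg.aestronglyMeasurable]

include hz in
theorem IsOnlineSample.memLp_comp {g : Vec d × ℝ → ℝ} {q : ENNReal} (hg : MemLp g q ν) (n : ℕ)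
    (r : Fin B) : MemLp (fun ω => g (z n r ω)) q μ := by
  rw [← hz.map_eq n r] at hg
  exact hg.comp_of_map (hz.measurable n r).aemeasurable

include hzw in
theorem indepFun_weight_sample (n : ℕ) {φ : (Fin B → ℝ) → ℝ} (hφ : Measurable φ)
    {ψ : (Fin B → Vec d × ℝ) → ℝ} (hψ : Measurable ψ) :
    IndepFun (fun ω => φ (w n ω)) (fun ω => ψ fun r => z n r ω) μ := by
  have h1 : Measurable fun v : ℕ → Fin B → ℝ => φ (v n) := hφ.comp (measurable_pi_apply n)
  have h2 : Measurable fun v : ℕ × Fin B → Vec d × ℝ => ψ fun r => v (n, r) :=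
    hψ.comp (by fun_prop)
  exact hzw.symm.comp h1 h2

include hz hw hzw in
theorem memLp_batchSum {g : Vec d × ℝ → ℝ} (hg : Measurable g) (hg2 : MemLp g 2 ν) (n : ℕ) :
    MemLp (fun ω => batchSum (w n ω) (fun r => z n r ω) g) 2 μ := by
  refine memLp_finsetSum _ fun r _ => ?_
  refine memLp_two_mul_of_indepFun ?_ (hw.memLp n r) (hz.memLp_comp hg2 n r)
  exact indepFun_weight_sample hzw n (φ := fun v => v r) (ψ := fun v => g (v r)) (by fun_prop)
    (by fun_prop)

variable [IsProbabilityMeasure μ]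

theorem IsSampling.integral_mul (hw : IsSampling μ b w) (n : ℕ) (r s : Fin B) :
    ∫ ω, w n ω r * w n ω s ∂μ =
      ((B : ℝ) - b) / (b * B * (B - 1)) * ((if r = s then 1 else 0) - 1 / (B : ℝ))
        + 1 / (B : ℝ) * (1 / (B : ℝ)) := by
  have h1 := covariance_eq_sub (hw.memLp n r) (hw.memLp n s)
  have h2 := congrFun (congrFun (hw.cov n) r) s
  simp only [Matrix.of_apply, Matrix.smul_apply, Matrix.sub_apply, Matrix.one_apply,
    Matrix.vecMulVec_apply, Pi.one_apply, smul_eq_mul, mul_one] at h2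
  rw [h2, hw.mean, hw.mean] at h1
  simp only [Pi.mul_apply] at h1
  linarith

theorem IsSampling.sum_integral_sq (hw : IsSampling μ b w) (hb : 1 ≤ b) (hB : b ≤ B) (n : ℕ) :
    ∑ r, ∫ ω, w n ω r * w n ω r ∂μ = 1 / (b : ℝ) := by
  simp only [hw.integral_mul, if_true, Finset.sum_const, Finset.card_univ, Fintype.card_fin,
    nsmul_eq_mul]
  have hb' : (b : ℝ) ≠ 0 := by positivity
  have hB' : (B : ℝ) ≠ 0 := by
    have : 1 ≤ B := hb.trans hB
    positivity
  -- for `B = 1` the factor `(B - b) / (b B (B - 1))` is `0 / 0 = 0`, the right covariance as `b = 1`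
  by_cases h1 : (B : ℝ) = 1
  · have : B = 1 := by exact_mod_cast h1
    have : b = 1 := by omega
    subst this
    simp [h1]
  · have : (B : ℝ) - 1 ≠ 0 := sub_ne_zero.2 h1
    field_simp
    ring

theorem IsSampling.sum_sum_integral_mul (hw : IsSampling μ b w) (hB : 1 ≤ B) (n : ℕ) :
    ∑ r, ∑ s, ∫ ω, w n ω r * w n ω s ∂μ = 1 := by
  have hB' : (B : ℝ) ≠ 0 := by positivity
  simp only [hw.integral_mul, Finset.sum_add_distrib, ← Finset.mul_sum, Finset.sum_sub_distrib,
    Finset.sum_ite_eq, Finset.mem_univ, if_true, Finset.sum_const, Finset.card_univ,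
    Fintype.card_fin, nsmul_eq_mul]
  field_simp
  ring

include hz hw hzw

theorem integral_batchSum [IsProbabilityMeasure ν] (hB : 1 ≤ B) {g : Vec d × ℝ → ℝ}
    (hg : Measurable g) (hg2 : MemLp g 2 ν) (n : ℕ) :
    ∫ ω, batchSum (w n ω) (fun r => z n r ω) g ∂μ = ∫ p, g p ∂ν := by
  have hind : ∀ r, IndepFun (fun ω => w n ω r) (fun ω => g (z n r ω)) μ := fun r =>
    indepFun_weight_sample hzw n (φ := fun v => v r) (ψ := fun v => g (v r)) (by fun_prop)
      (by fun_prop)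
  have hgz := fun r => hz.memLp_comp hg2 n r
  unfold batchSum
  rw [integral_finsetSum _ fun r _ => (memLp_two_mul_of_indepFun (hind r) (hw.memLp n r)
    (hgz r)).integrable (by norm_num)]
  have : ∀ r, ∫ ω, w n ω r * g (z n r ω) ∂μ = 1 / (B : ℝ) * ∫ p, g p ∂ν := fun r => by
    rw [(hind r).integral_fun_mul_eq_mul_integral (hw.memLp n r).aestronglyMeasurable
      (hgz r).aestronglyMeasurable, hw.mean, hz.integral_comp hg]
  have hB' : (B : ℝ) ≠ 0 := by positivity
  simp only [this, Finset.sum_const, Finset.card_univ, Fintype.card_fin, nsmul_eq_mul]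
  field_simp

/-- The second moments of batch sums depend on the weights only through `E ∑_r w_r² = 1/b` and
`E (∑_r w_r)² = 1`. This is what makes the large and the small batch indistinguishable. -/
theorem integral_batchSum_mul [IsProbabilityMeasure ν] (hb : 1 ≤ b) (hB : b ≤ B)
    {g h : Vec d × ℝ → ℝ} (hg : Measurable g) (hg2 : MemLp g 2 ν) (hh : Measurable h)
    (hh2 : MemLp h 2 ν) (n : ℕ) :
    ∫ ω, batchSum (w n ω) (fun r => z n r ω) g * batchSum (w n ω) (fun r => z n r ω) h ∂μ =
      1 / (b : ℝ) * ∫ p, g p * h p ∂ν + (1 - 1 / (b : ℝ)) * ((∫ p, g p ∂ν) * ∫ p, h p ∂ν) := by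
  have hgz := fun r => hz.memLp_comp hg2 n r
  have hhz := fun r => hz.memLp_comp hh2 n r
  have hind : ∀ r s, IndepFun (fun ω => w n ω r * w n ω s) (fun ω => g (z n r ω) * h (z n s ω)) μ :=
    fun r s => indepFun_weight_sample hzw n (φ := fun v => v r * v s)
      (ψ := fun v => g (v r) * h (v s)) (by fun_prop) (by fun_prop)
  have hww : ∀ r s, Integrable (fun ω => w n ω r * w n ω s) μ := fun r s =>
    (hw.memLp n r).integrable_mul (hw.memLp n s)
  have hgh : ∀ r s, Integrable (fun ω => g (z n r ω) * h (z n s ω)) μ := fun r s =>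
    (hgz r).integrable_mul (hhz s)
  have hval : ∀ r s, ∫ ω, g (z n r ω) * h (z n s ω) ∂μ =
      (if r = s then (∫ p, g p * h p ∂ν) - (∫ p, g p ∂ν) * ∫ p, h p ∂ν else 0)
        + (∫ p, g p ∂ν) * ∫ p, h p ∂ν := by
    intro r s
    split_ifs with hrs
    · subst hrs
      rw [hz.integral_comp (g := fun p => g p * h p) (hg.mul hh)]
      ring
    · have hne : (n, r) ≠ (n, s) := fun h => hrs (Prod.ext_iff.1 h).2
      have := ((hz.indep.indepFun hne).comp hg hh).integral_mul_eq_mul_integral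
        (hgz r).aestronglyMeasurable (hhz s).aestronglyMeasurable
      simp only [Pi.mul_apply, Function.comp] at this
      rw [this, hz.integral_comp hg, hz.integral_comp hh, zero_add]
  have hterm : ∀ r s, ∫ ω, w n ω r * g (z n r ω) * (w n ω s * h (z n s ω)) ∂μ =
      (∫ ω, w n ω r * w n ω s ∂μ) * ∫ ω, g (z n r ω) * h (z n s ω) ∂μ := fun r s => by
    rw [← (hind r s).integral_fun_mul_eq_mul_integral (hww r s).aestronglyMeasurable
      (hgh r s).aestronglyMeasurable]
    exact integral_congr_ae (Filter.Eventually.of_forall fun ω => by ring)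
  have hint : ∀ r s, Integrable (fun ω => w n ω r * g (z n r ω) * (w n ω s * h (z n s ω))) μ :=
    fun r s => ((hind r s).integrable_mul (hww r s) (hgh r s)).congr
      (Filter.Eventually.of_forall fun ω => by simp only [Pi.mul_apply]; ring)
  simp only [batchSum, Finset.sum_mul_sum]
  rw [integral_finsetSum _ fun r _ => integrable_finsetSum _ fun s _ => hint r s]
  simp only [integral_finsetSum _ fun s _ => hint _ s, hterm, hval, mul_add,
    Finset.sum_add_distrib, mul_ite, mul_zero, Finset.sum_ite_eq, Finset.mem_univ, if_true,
    ← Finset.sum_mul]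
  rw [hw.sum_integral_sq hb hB, hw.sum_sum_integral_mul (hb.trans hB)]
  ring

end Moments

/-! ### Independence of the steps -/

section Steps

variable {d b B : ℕ} {Ω : Type*} {z : ℕ → Fin B → Ω → Vec d × ℝ} {w : ℕ → Ω → Fin B → ℝ}

/-- The σ-algebra generated by the samples and weights of the steps in `T`. -/
abbrev stepSigma (z : ℕ → Fin B → Ω → Vec d × ℝ) (w : ℕ → Ω → Fin B → ℝ) (T : Set ℕ) :
    MeasurableSpace Ω :=
  ⨆ i ∈ {i : (ℕ × Fin B) ⊕ ℕ | Sum.elim Prod.fst id i ∈ T},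
    Sum.elim (fun k : ℕ × Fin B => MeasurableSpace.comap (z k.1 k.2) inferInstance)
      (fun n => MeasurableSpace.comap (w n) inferInstance) i

theorem stepSigma_mono {T T' : Set ℕ} (h : T ⊆ T') : stepSigma z w T ≤ stepSigma z w T' :=
  biSup_mono fun _ hi => h hi

theorem measurable_sample_stepSigma {T : Set ℕ} {n : ℕ} (hn : n ∈ T) (r : Fin B) :
    Measurable[stepSigma z w T] (z n r) := by
  rw [measurable_iff_comap_le]
  exact le_iSup₂_of_le (Sum.inl (n, r)) hn le_rfl

theorem measurable_weight_stepSigma {T : Set ℕ} {n : ℕ} (hn : n ∈ T) :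
    Measurable[stepSigma z w T] (w n) := by
  rw [measurable_iff_comap_le]
  exact le_iSup₂_of_le (Sum.inr n) hn le_rfl

theorem measurable_batchSum {F : MeasurableSpace Ω} {w : Ω → Fin B → ℝ}
    {z : Fin B → Ω → Vec d × ℝ} (hw : Measurable[F] w) (hz : ∀ r, Measurable[F] (z r))
    {g : Vec d × ℝ → ℝ} (hg : Measurable g) :
    Measurable[F] fun ω => batchSum (w ω) (fun r => z r ω) g :=
  Finset.measurable_sum _ fun r _ => ((measurable_pi_apply r).comp hw).mul (hg.comp (hz r))

variable [m : MeasurableSpace Ω] {μ : Measure Ω} {ν : Measure (Vec d × ℝ)}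

theorem indep_stepSigma (hz : IsOnlineSample μ ν z) (hw : IsSampling μ b w)
    (hzw : IndepFun (fun ω (k : ℕ × Fin B) => z k.1 k.2 ω) (fun ω n => w n ω) μ)
    {T T' : Set ℕ} (h : Disjoint T T') : Indep (stepSigma z w T) (stepSigma z w T') μ := by
  refine indep_iSup_of_disjoint ?_ (iIndep_sumElim hz.indep.iIndep hw.indep.iIndep ?_) ?_
  · rintro (k | n)
    exacts [(hz.measurable k.1 k.2).comap_le, (hw.measurable n).comap_le]
  · rw [IndepFun_iff_Indep] at hzw
    refine indep_of_indep_of_le_left (indep_of_indep_of_le_right hzw ?_) ?_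
    · exact iSup_le fun n => by
        rw [← measurable_iff_comap_le]
        exact (measurable_pi_apply n).comp (comap_measurable fun ω n => w n ω)
    · exact iSup_le fun k => by
        rw [← measurable_iff_comap_le]
        exact (measurable_pi_apply k).comp
          (comap_measurable fun ω (k : ℕ × Fin B) => z k.1 k.2 ω)
  · exact Set.disjoint_left.2 fun i hi hi' => Set.disjoint_left.1 h hi hi'

end Steps

/-! ### Moments of one sample -/

/-- The covariance operator `Σ` as a linear map of the Euclidean space. -/
def covOp {d : ℕ} (ν : Measure (Vec d × ℝ)) : Vec d →ₗ[ℝ] Vec d :=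
  Matrix.toEuclideanLin (secondMoment ν)

theorem measurable_residual {d : ℕ} (ν : Measure (Vec d × ℝ)) : Measurable (residual ν) := by
  unfold residual
  fun_prop

section Law

variable {d : ℕ} {ν : Measure (Vec d × ℝ)} {R σ lam : ℝ}

/-- The quadratic form of a weighted second moment matrix `E[c x xᵀ]`. -/
theorem dotProduct_mulVec_moment {c : Vec d × ℝ → ℝ}
    (hc : ∀ i j, Integrable (fun p : Vec d × ℝ => c p * (p.1 i * p.1 j)) ν) (v v' : Vec d) :
    v.ofLp ⬝ᵥ (Matrix.of fun i j => ∫ p, c p * (p.1 i * p.1 j) ∂ν).mulVec v'.ofLp =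
      ∫ p, c p * (inner ℝ p.1 v * inner ℝ p.1 v') ∂ν := by
  have h : ∀ p : Vec d × ℝ, c p * (inner ℝ p.1 v * inner ℝ p.1 v') =
      ∑ i, ∑ j, v i * ((c p * (p.1 i * p.1 j)) * v' j) := fun p => by
    simp only [PiLp.inner_apply, RCLike.inner_apply, conj_trivial, Finset.sum_mul_sum]
    simp only [Finset.mul_sum]
    exact Finset.sum_congr rfl fun i _ => Finset.sum_congr rfl fun j _ => by ring
  simp only [h]
  rw [integral_finsetSum _ fun i _ => integrable_finsetSum _ fun j _ =>
    ((hc i j).mul_const _).const_mul _]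
  simp only [integral_finsetSum _ fun j _ => ((hc _ j).mul_const _).const_mul _,
    integral_const_mul, integral_mul_const, dotProduct, Matrix.mulVec, Matrix.of_apply,
    Finset.mul_sum]

theorem memLp_four_mul {f g : Vec d × ℝ → ℝ} (hf : MemLp f 4 ν) (hg : MemLp g 4 ν) :
    MemLp (fun p => f p * g p) 2 ν := by
  have : ENNReal.HolderTriple 4 4 2 := ⟨by
    rw [← two_mul, show (4 : ENNReal) = 2 * 2 by norm_num, ENNReal.mul_inv (by simp) (by simp),
      ← mul_assoc, ENNReal.mul_inv_cancel (by simp) (by simp), one_mul]⟩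
  exact hg.mul hf

theorem integral_mul_inner_sq_le {c : Vec d × ℝ → ℝ} {K : ℝ}
    (hc : ∀ i j, Integrable (fun p : Vec d × ℝ => c p * (p.1 i * p.1 j)) ν)
    (hK : (K • secondMoment ν -
      Matrix.of fun i j => ∫ p, c p * (p.1 i * p.1 j) ∂ν).PosSemidef) (v : Vec d) :
    ∫ p, c p * inner ℝ p.1 v ^ 2 ∂ν ≤ K * inner ℝ v (covOp ν v) := by
  have := hK.dotProduct_mulVec_nonneg v.ofLp
  rw [Matrix.sub_mulVec, Matrix.smul_mulVec, dotProduct_sub, dotProduct_smul,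
    sub_nonneg, star_trivial, dotProduct_mulVec_moment hc] at this
  have h1 : inner ℝ v (covOp ν v) = v.ofLp ⬝ᵥ (secondMoment ν).mulVec v.ofLp := by
    simp [covOp, Matrix.toLpLin_apply, PiLp.inner_apply, dotProduct, mul_comm]
  simp only [sq]
  rwa [h1]

variable (h : Assumptions ν R σ lam)

include h

theorem Assumptions.memLp_inner (v : Vec d) :
    MemLp (fun p : Vec d × ℝ => (inner ℝ p.1 v : ℝ)) 4 ν :=
  h.memLp_fst.inner_const v

theorem Assumptions.memLp_inner_mul (v v' : Vec d) :
    MemLp (fun p : Vec d × ℝ => (inner ℝ p.1 v * inner ℝ p.1 v' : ℝ)) 2 ν :=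
  memLp_four_mul (h.memLp_inner v) (h.memLp_inner v')

theorem Assumptions.memLp_noise (v : Vec d) :
    MemLp (fun p : Vec d × ℝ => residual ν p * inner ℝ p.1 v) 2 ν := by
  have hm : Measurable fun p : Vec d × ℝ => residual ν p * inner ℝ p.1 v :=
    (measurable_residual ν).mul (by fun_prop)
  rw [memLp_two_iff_integrable_sq hm.aestronglyMeasurable]
  refine (h.integrable_noise.mul_const (‖v‖ ^ 2)).mono'
    (hm.pow_const 2).aestronglyMeasurable (Filter.Eventually.of_forall fun p => ?_)
  rw [Real.norm_of_nonneg (by positivity), mul_pow, mul_assoc, ← mul_pow ‖p.1‖]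
  refine mul_le_mul_of_nonneg_left (sq_le_sq' ?_ (real_inner_le_norm _ _)) (sq_nonneg _)
  exact neg_le_of_abs_le (abs_real_inner_le_norm p.1 v)

theorem Assumptions.covOp_le (v : Vec d) : inner ℝ v (covOp ν v) ≤ lam * ‖v‖ ^ 2 := by
  have := h.secondMoment_le.dotProduct_mulVec_nonneg v.ofLp
  rw [Matrix.sub_mulVec, Matrix.smul_mulVec, Matrix.one_mulVec, dotProduct_sub, dotProduct_smul,
    sub_nonneg] at this
  have h1 : inner ℝ v (covOp ν v) = star v.ofLp ⬝ᵥ (secondMoment ν).mulVec v.ofLp := by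
    simp [covOp, Matrix.toLpLin_apply, PiLp.inner_apply, dotProduct, mul_comm]
  have h2 : ‖v‖ ^ 2 = star v.ofLp ⬝ᵥ v.ofLp := by
    rw [EuclideanSpace.norm_sq_eq]
    simp [dotProduct, sq]
  rw [h1, h2]
  exact this

theorem Assumptions.integral_norm_sq_mul_le (v : Vec d) :
    ∫ p, ‖p.1‖ ^ 2 * inner ℝ p.1 v ^ 2 ∂ν ≤ R ^ 2 * inner ℝ v (covOp ν v) := by
  refine integral_mul_inner_sq_le (fun i j => ?_) h.fourthMoment_le v
  have h1 := h.memLp_inner_mul (EuclideanSpace.single i 1) (EuclideanSpace.single j 1)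
  have h2 := memLp_four_mul h.memLp_fst.norm h.memLp_fst.norm
  have := h2.integrable_mul h1
  simpa [EuclideanSpace.inner_single_right, sq, Pi.mul_def] using this

theorem Assumptions.integral_residual_sq_mul_le (v : Vec d) :
    ∫ p, (residual ν p * inner ℝ p.1 v) ^ 2 ∂ν ≤ σ ^ 2 * inner ℝ v (covOp ν v) := by
  simp only [mul_pow]
  refine integral_mul_inner_sq_le (fun i j => ?_) h.noiseMoment_le v
  have h1 := h.memLp_noise (EuclideanSpace.single i 1)
  have h2 := h.memLp_noise (EuclideanSpace.single j 1)
  refine (h1.integrable_mul h2).congr (Filter.Eventually.of_forall fun p => ?_)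
  simp [EuclideanSpace.inner_single_right]
  ring

variable [IsProbabilityMeasure ν]

theorem Assumptions.inner_covOp (v v' : Vec d) :
    inner ℝ v (covOp ν v') = ∫ p, inner ℝ p.1 v * inner ℝ p.1 v' ∂ν := by
  have hi : ∀ i j, Integrable (fun p : Vec d × ℝ => (1 : ℝ) * (p.1 i * p.1 j)) ν := fun i j => by
    have := (h.memLp_inner_mul (EuclideanSpace.single i 1)
      (EuclideanSpace.single j 1)).integrable (by norm_num)
    simpa [EuclideanSpace.inner_single_right] using this
  have := dotProduct_mulVec_moment hi v v'
  simp only [one_mul] at this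
  rw [← this, covOp, Matrix.toLpLin_apply]
  simp [PiLp.inner_apply, dotProduct, secondMoment, mul_comm]

theorem Assumptions.inner_covOp_self (v : Vec d) :
    inner ℝ v (covOp ν v) = ∫ p, inner ℝ p.1 v ^ 2 ∂ν := by
  simp only [h.inner_covOp, sq]

theorem Assumptions.inner_covOp_self_nonneg (v : Vec d) : 0 ≤ inner ℝ v (covOp ν v) := by
  rw [h.inner_covOp_self]
  positivity

theorem Assumptions.inner_covOp_comm (v v' : Vec d) :
    inner ℝ v (covOp ν v') = inner ℝ v' (covOp ν v) := by
  simp only [h.inner_covOp, mul_comm]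

/-- A vector in the kernel of `Σ` is almost surely orthogonal to the features. -/
theorem Assumptions.inner_ae_eq_zero {k : Vec d} (hk : covOp ν k = 0) :
    ∀ᵐ p ∂ν, inner ℝ p.1 k = (0 : ℝ) := by
  have h0 := h.inner_covOp_self k
  rw [hk, inner_zero_right] at h0
  have hi : Integrable (fun p : Vec d × ℝ => (inner ℝ p.1 k : ℝ) ^ 2) ν := by
    simpa [sq] using (h.memLp_inner_mul k k).integrable (by norm_num)
  have := (integral_eq_zero_iff_of_nonneg (fun p => sq_nonneg _) hi).1 h0.symm
  filter_upwards [this] with p hp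
  simpa using hp

end Law

/-! ### The optimum and the excess risk -/

/-- The Moore-Penrose inverse `Σ†` as a linear map of the Euclidean space. -/
def pinvOp {d : ℕ} (ν : Measure (Vec d × ℝ)) : Vec d →ₗ[ℝ] Vec d :=
  Matrix.toEuclideanLin (pinv (secondMoment_isHermitian ν))

theorem pinv_isHermitian {d : ℕ} {A : Matrix (Fin d) (Fin d) ℝ} (hA : A.IsHermitian) :
    (pinv hA).IsHermitian := by
  rw [pinv, Matrix.IsHermitian, ← Matrix.star_eq_conjTranspose, Matrix.IsHermitian.cfc, ← map_star]
  congr 1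
  rw [Matrix.star_eq_conjTranspose, Matrix.diagonal_conjTranspose]
  congr 1

theorem optimum_eq {d : ℕ} (ν : Measure (Vec d × ℝ)) :
    optimum ν = pinvOp ν (crossMoment ν) := by
  rw [pinvOp, Matrix.toLpLin_apply, optimum]

theorem covOp_covOp_pinvOp {d : ℕ} (ν : Measure (Vec d × ℝ)) (v : Vec d) :
    covOp ν (covOp ν (pinvOp ν v)) = covOp ν v := by
  have hS := secondMoment_isHermitian ν
  obtain ⟨h1, -, h3, -⟩ := pinv_spec hS
  have h4 : secondMoment ν * (secondMoment ν * pinv hS) = secondMoment ν := by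
    have := congrArg Matrix.conjTranspose h1
    rwa [Matrix.conjTranspose_mul, h3.eq, hS.eq] at this
  simp only [covOp, pinvOp, Matrix.toLpLin_apply, Matrix.mulVec_mulVec, h4]

theorem initialGap_eq {d : ℕ} (ν : Measure (Vec d × ℝ)) (θ : Vec d) :
    initialGap ν θ =
      inner ℝ (pinvOp ν (θ - optimum ν)) (covOp ν (pinvOp ν (θ - optimum ν))) := by
  have hS := secondMoment_isHermitian ν
  obtain ⟨-, h2, -, -⟩ := pinv_spec hS
  set u := θ - optimum ν
  have h4 : pinv hS = (pinv hS).transpose := by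
    have := pinv_isHermitian hS
    rw [Matrix.IsHermitian, Matrix.conjTranspose_eq_transpose_of_trivial] at this
    exact this.symm
  have h5 : inner ℝ (pinvOp ν u) (covOp ν (pinvOp ν u)) =
      (pinv hS).mulVec u.ofLp ⬝ᵥ (secondMoment ν).mulVec ((pinv hS).mulVec u.ofLp) := by
    simp [covOp, pinvOp, Matrix.toLpLin_apply, PiLp.inner_apply, dotProduct, mul_comm]
  have h6 : (pinv hS).mulVec u.ofLp = Matrix.vecMul u.ofLp (pinv hS) := by
    conv_lhs => rw [h4]
    exact Matrix.mulVec_transpose _ _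
  rw [h5, initialGap]
  nth_rewrite 2 [h6]
  rw [← Matrix.dotProduct_mulVec, Matrix.mulVec_mulVec, Matrix.mulVec_mulVec, h2]

section Law

variable {d : ℕ} {ν : Measure (Vec d × ℝ)} [IsProbabilityMeasure ν] {R σ lam : ℝ}

theorem Assumptions.memLp_inner_two (h : Assumptions ν R σ lam) (v : Vec d) :
    MemLp (fun p : Vec d × ℝ => (inner ℝ p.1 v : ℝ)) 2 ν :=
  (h.memLp_inner v).mono_exponent (by norm_num)

theorem Assumptions.memLp_residual (h : Assumptions ν R σ lam) : MemLp (residual ν) 2 ν :=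
  h.memLp_snd.sub (h.memLp_inner_two _)

/-- Cauchy-Schwarz in the form of `Σ`: the outer product of `Σ u` with itself is at most
`(uᵀ Σ u) Σ`. -/
theorem Assumptions.inner_covOp_sq_le (h : Assumptions ν R σ lam) (u v : Vec d) :
    inner ℝ v (covOp ν u) ^ 2 ≤ inner ℝ u (covOp ν u) * inner ℝ v (covOp ν v) := by
  -- the discriminant of the nonnegative polynomial `t ↦ ⟨u + t v, Σ (u + t v)⟩`
  have hq : ∀ t : ℝ, 0 ≤ inner ℝ v (covOp ν v) * (t * t) + 2 * inner ℝ v (covOp ν u) * t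
      + inner ℝ u (covOp ν u) := fun t => by
    have := h.inner_covOp_self_nonneg (u + t • v)
    simp only [map_add, map_smul, inner_add_left, inner_add_right, real_inner_smul_left,
      real_inner_smul_right] at this
    rw [h.inner_covOp_comm u v] at this
    linarith
  have := discrim_le_zero hq
  rw [discrim] at this
  linarith

/-- `Σ² ⪯ λ Σ`, from `Σ ⪯ λ I` and the Cauchy-Schwarz inequality for the form of `Σ`. -/
theorem Assumptions.norm_covOp_sq_le (h : Assumptions ν R σ lam) (v : Vec d) :
    ‖covOp ν v‖ ^ 2 ≤ lam * inner ℝ v (covOp ν v) := by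
  set u := covOp ν v with hu
  have hcs := h.inner_covOp_sq_le v u
  rw [← hu, real_inner_self_eq_norm_sq] at hcs
  have hle := h.covOp_le u
  have h0 := h.inner_covOp_self_nonneg v
  rw [← hu] at h0
  by_cases hz : u = 0
  · simp [hz]
  · have hpos : 0 < ‖u‖ ^ 2 := by positivity
    refine le_of_mul_le_mul_left ?_ hpos
    calc ‖u‖ ^ 2 * ‖u‖ ^ 2 = (‖u‖ ^ 2) ^ 2 := by ring
      _ ≤ _ := hcs
      _ ≤ inner ℝ v u * (lam * ‖u‖ ^ 2) := by gcongr
      _ = _ := by ring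

theorem Assumptions.inner_crossMoment (h : Assumptions ν R σ lam) (v : Vec d) :
    inner ℝ v (crossMoment ν) = ∫ p, p.2 * inner ℝ p.1 v ∂ν := by
  have hi : ∀ i, Integrable (fun p : Vec d × ℝ => p.2 * p.1 i) ν := fun i => by
    have := h.memLp_snd.integrable_mul (h.memLp_inner_two (EuclideanSpace.single i 1))
    simpa [EuclideanSpace.inner_single_right, Pi.mul_def] using this
  have : ∀ p : Vec d × ℝ, p.2 * inner ℝ p.1 v = ∑ i, v i * (p.2 * p.1 i) := fun p => by
    simp only [PiLp.inner_apply, RCLike.inner_apply, conj_trivial, Finset.mul_sum]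
    exact Finset.sum_congr rfl fun i _ => by ring
  simp only [this]
  rw [integral_finsetSum _ fun i _ => (hi i).const_mul _]
  simp only [integral_const_mul, crossMoment, PiLp.inner_apply, RCLike.inner_apply, conj_trivial]
  exact Finset.sum_congr rfl fun i _ => by ring

/-- The normal equations `Σ θ_* = E[y x]`: the vector `E[y x]` lies in the range of `Σ`, because
the features are almost surely orthogonal to the kernel of `Σ`. -/
theorem Assumptions.covOp_optimum (h : Assumptions ν R σ lam) :
    covOp ν (optimum ν) = crossMoment ν := by
  rw [optimum_eq]
  set c := crossMoment ν
  have hk : covOp ν (c - covOp ν (pinvOp ν c)) = 0 := by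
    rw [map_sub, covOp_covOp_pinvOp, sub_self]
  set k := c - covOp ν (pinvOp ν c) with hkdef
  have h1 : inner ℝ k c = (0 : ℝ) := by
    rw [h.inner_crossMoment]
    refine integral_eq_zero_of_ae ?_
    filter_upwards [h.inner_ae_eq_zero hk] with p hp
    simp [hp]
  have h2 : inner ℝ k (covOp ν (pinvOp ν c)) = (0 : ℝ) := by
    rw [h.inner_covOp_comm, hk, inner_zero_right]
  have h3 : inner ℝ k k = (0 : ℝ) := by
    nth_rewrite 2 [hkdef]
    rw [inner_sub_right, h1, h2, sub_self]
  exact (sub_eq_zero.1 (inner_self_eq_zero.1 h3)).symm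

theorem Assumptions.integral_residual_mul_inner (h : Assumptions ν R σ lam) (v : Vec d) :
    ∫ p, residual ν p * inner ℝ p.1 v ∂ν = 0 := by
  have h1 : Integrable (fun p : Vec d × ℝ => p.2 * (inner ℝ p.1 v : ℝ)) ν :=
    h.memLp_snd.integrable_mul (h.memLp_inner_two v)
  have h2 : Integrable (fun p : Vec d × ℝ => (inner ℝ p.1 v * inner ℝ p.1 (optimum ν) : ℝ)) ν :=
    (h.memLp_inner_mul v (optimum ν)).integrable (by norm_num)
  have : ∀ p : Vec d × ℝ, residual ν p * inner ℝ p.1 v =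
      p.2 * inner ℝ p.1 v - inner ℝ p.1 v * inner ℝ p.1 (optimum ν) := fun p => by
    rw [residual]; ring
  simp only [this]
  rw [integral_sub h1 h2, ← h.inner_crossMoment, ← h.inner_covOp, h.covOp_optimum, sub_self]

/-- The risk is a quadratic function with minimizer `θ_*` and Hessian `Σ`. -/
theorem Assumptions.risk_eq (h : Assumptions ν R σ lam) (θ : Vec d) :
    risk ν θ = risk ν (optimum ν) +
      (1 / 2) * inner ℝ (θ - optimum ν) (covOp ν (θ - optimum ν)) := by
  set u := θ - optimum ν with hu
  have h1 : ∀ p : Vec d × ℝ, (inner ℝ p.1 θ - p.2) ^ 2 =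
      residual ν p ^ 2 + inner ℝ p.1 u ^ 2 - 2 * (residual ν p * inner ℝ p.1 u) := fun p => by
    rw [residual, hu, inner_sub_right]; ring
  have h2 : ∀ p : Vec d × ℝ, (inner ℝ p.1 (optimum ν) - p.2) ^ 2 = residual ν p ^ 2 := fun p => by
    rw [residual]; ring
  have i1 := h.memLp_residual.integrable_sq
  have i2 := (h.memLp_inner_two u).integrable_sq
  have i3 := (h.memLp_residual.integrable_mul (h.memLp_inner_two u)).const_mul 2
  simp only [Pi.mul_apply] at i3
  rw [risk, risk]
  simp only [h1, h2]
  have i12 : Integrable (fun p : Vec d × ℝ => residual ν p ^ 2 + (inner ℝ p.1 u : ℝ) ^ 2) ν :=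
    i1.add i2
  rw [integral_sub i12 i3, integral_add i1 i2, integral_const_mul,
    h.integral_residual_mul_inner, h.inner_covOp_self]
  ring

end Law

/-! ### The second moments of one step -/

/-- The `j`-th coordinate of `x xᵀ v`, as a function of the sample. -/
def gramFun {d : ℕ} (v : Vec d) (j : Fin d) (p : Vec d × ℝ) : ℝ := inner ℝ p.1 v * p.1 j

/-- The step of the algorithm multiplies the error by `I - η ∑_r w_r x_r x_rᵀ`; this is the
`j`-th coordinate of the (symmetric) factor applied to `v`. -/
def stepVec {d B : ℕ} (η : ℝ) (w : Fin B → ℝ) (z : Fin B → Vec d × ℝ) (v : Vec d) (j : Fin d) : ℝ :=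
  v j - η * batchSum w z (gramFun v j)

/-- The expectation of the product of the coordinates `j` and `k` of the step applied to `v`. It
involves the data law and `b`, but neither the batch size nor the law of the weights. -/
def stepMoment {d : ℕ} (ν : Measure (Vec d × ℝ)) (b : ℕ) (η : ℝ) (v : Vec d) (j k : Fin d) : ℝ :=
  v j * v k - η * (v j * ∫ p, gramFun v k p ∂ν) - η * (v k * ∫ p, gramFun v j p ∂ν) +
    η ^ 2 * (1 / (b : ℝ) * ∫ p, gramFun v j p * gramFun v k p ∂ν +
      (1 - 1 / (b : ℝ)) * ((∫ p, gramFun v j p ∂ν) * ∫ p, gramFun v k p ∂ν))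

theorem measurable_gramFun {d : ℕ} (v : Vec d) (j : Fin d) : Measurable (gramFun v j) := by
  unfold gramFun
  fun_prop

section Law

variable {d b : ℕ} {ν : Measure (Vec d × ℝ)} {R σ lam η : ℝ}

theorem Assumptions.memLp_gramFun (h : Assumptions ν R σ lam) (v : Vec d) (j : Fin d) :
    MemLp (gramFun v j) 2 ν := by
  have := h.memLp_inner_mul v (EuclideanSpace.single j 1)
  simp only [EuclideanSpace.inner_single_right, conj_trivial, one_mul] at this
  exact this

theorem Assumptions.sum_integral_gramFun_sq_le (h : Assumptions ν R σ lam) (v : Vec d) :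
    ∑ j, ∫ p, gramFun v j p * gramFun v j p ∂ν ≤ R ^ 2 * inner ℝ v (covOp ν v) := by
  refine le_of_eq_of_le ?_ (h.integral_norm_sq_mul_le v)
  rw [← integral_finsetSum _ fun j _ =>
    integrable_mul_of_memLp_two (h.memLp_gramFun v j) (h.memLp_gramFun v j)]
  refine integral_congr_ae (Filter.Eventually.of_forall fun p => ?_)
  simp only [EuclideanSpace.real_norm_sq_eq, Finset.sum_mul, gramFun]
  exact Finset.sum_congr rfl fun j _ => by ring

theorem real_inner_eq_sum_mul {d : ℕ} (a c : Vec d) : inner ℝ a c = ∑ j, a j * c j := by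
  simp [PiLp.inner_apply, mul_comm]

theorem norm_sq_eq_sum_mul {d : ℕ} (v : Vec d) : ‖v‖ ^ 2 = ∑ j, v j * v j := by
  rw [EuclideanSpace.real_norm_sq_eq]
  simp only [sq]

variable [IsProbabilityMeasure ν]

theorem Assumptions.integral_gramFun (h : Assumptions ν R σ lam) (v : Vec d) (j : Fin d) :
    ∫ p, gramFun v j p ∂ν = covOp ν v j := by
  have := h.inner_covOp (EuclideanSpace.single j 1) v
  simp only [EuclideanSpace.inner_single_left, EuclideanSpace.inner_single_right, map_one,
    one_mul, conj_trivial] at this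
  rw [this]
  exact integral_congr_ae (Filter.Eventually.of_forall fun p => by simp only [gramFun, mul_comm])

theorem Assumptions.sum_stepMoment_eq (h : Assumptions ν R σ lam) (v : Vec d) :
    ∑ j, stepMoment ν b η v j j = ‖v‖ ^ 2 - 2 * η * inner ℝ v (covOp ν v) +
      η ^ 2 * (1 / (b : ℝ) * ∑ j, ∫ p, gramFun v j p * gramFun v j p ∂ν +
        (1 - 1 / (b : ℝ)) * ‖covOp ν v‖ ^ 2) := by
  rw [norm_sq_eq_sum_mul, norm_sq_eq_sum_mul, real_inner_eq_sum_mul]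
  simp only [stepMoment, h.integral_gramFun, Finset.sum_add_distrib, Finset.sum_sub_distrib,
    ← Finset.mul_sum]
  ring

theorem Assumptions.inner_sub_covOp_comm (h : Assumptions ν R σ lam) (u v : Vec d) :
    inner ℝ v (u - η • covOp ν u) = inner ℝ (v - η • covOp ν v) u := by
  rw [inner_sub_right, inner_sub_left, real_inner_smul_right, real_inner_smul_left,
    h.inner_covOp_comm, real_inner_comm u (covOp ν v), real_inner_comm u v]

/-- In expectation a step decreases the squared norm by `η (2 - η ρ) vᵀ Σ v`, where
`ρ = (R² + (b - 1) λ) / b`. -/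
theorem Assumptions.sum_stepMoment_le (h : Assumptions ν R σ lam) (hb : 1 ≤ b) (v : Vec d) :
    ∑ j, stepMoment ν b η v j j ≤ ‖v‖ ^ 2 -
      η * (2 - η * ((R ^ 2 + ((b : ℝ) - 1) * lam) / b)) * inner ℝ v (covOp ν v) := by
  have h1 := h.sum_integral_gramFun_sq_le v
  have h2 := h.norm_covOp_sq_le v
  have hb' : (1 : ℝ) ≤ b := by exact_mod_cast hb
  have hb0 : (b : ℝ) ≠ 0 := by positivity
  have hb1 : 0 ≤ 1 - 1 / (b : ℝ) := sub_nonneg.2 ((div_le_one (by positivity)).2 hb')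
  rw [h.sum_stepMoment_eq]
  calc _ ≤ ‖v‖ ^ 2 - 2 * η * inner ℝ v (covOp ν v) +
      η ^ 2 * (1 / (b : ℝ) * (R ^ 2 * inner ℝ v (covOp ν v)) +
        (1 - 1 / (b : ℝ)) * (lam * inner ℝ v (covOp ν v))) := by gcongr
    _ = _ := by field_simp; ring

/-- `I - η Σ` is a contraction, although `η Σ ⪯ I` may fail: it is the expectation of a random
matrix that decreases the expected squared norm. -/
theorem Assumptions.norm_sub_covOp_le (h : Assumptions ν R σ lam) (hb : 1 ≤ b) (hη : 0 < η)
    (hstep : η * ((R ^ 2 + ((b : ℝ) - 1) * lam) / b) < 2) (v : Vec d) :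
    ‖v - η • covOp ν v‖ ^ 2 ≤ ‖v‖ ^ 2 := by
  have h1 := h.sum_stepMoment_le (η := η) hb v
  have h0 := h.inner_covOp_self_nonneg v
  rw [h.sum_stepMoment_eq] at h1
  have hb0 : (0 : ℝ) < b := by positivity
  have hJ : ‖covOp ν v‖ ^ 2 ≤ ∑ j, ∫ p, gramFun v j p * gramFun v j p ∂ν := by
    rw [norm_sq_eq_sum_mul]
    refine Finset.sum_le_sum fun j _ => ?_
    have := variance_nonneg (gramFun v j) ν
    rw [variance_eq_sub (h.memLp_gramFun v j), h.integral_gramFun, sub_nonneg] at this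
    simpa [sq] using this
  have h3 : 0 ≤ η * (2 - η * ((R ^ 2 + ((b : ℝ) - 1) * lam) / b)) * inner ℝ v (covOp ν v) :=
    mul_nonneg (mul_nonneg hη.le (by linarith)) h0
  have h4 : η ^ 2 * ‖covOp ν v‖ ^ 2 ≤
      η ^ 2 * (1 / (b : ℝ) * ∑ j, ∫ p, gramFun v j p * gramFun v j p ∂ν +
        (1 - 1 / (b : ℝ)) * ‖covOp ν v‖ ^ 2) := by
    refine mul_le_mul_of_nonneg_left ?_ (sq_nonneg η)
    have : 0 ≤ 1 / (b : ℝ) * (∑ j, ∫ p, gramFun v j p * gramFun v j p ∂ν - ‖covOp ν v‖ ^ 2) :=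
      mul_nonneg (by positivity) (sub_nonneg.2 hJ)
    linarith
  rw [norm_sub_sq_real, norm_smul, mul_pow, Real.norm_eq_abs, sq_abs, real_inner_smul_right]
  linarith

end Law

section Step

variable {d b B : ℕ} {Ω : Type*} [MeasurableSpace Ω] {μ : Measure Ω} [IsProbabilityMeasure μ]
  {ν : Measure (Vec d × ℝ)}
  {z : ℕ → Fin B → Ω → Vec d × ℝ} {w : ℕ → Ω → Fin B → ℝ} {R σ lam η : ℝ}
  (h : Assumptions ν R σ lam) (hb : 1 ≤ b) (hB : b ≤ B)
  (hz : IsOnlineSample μ ν z) (hw : IsSampling μ b w)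
  (hzw : IndepFun (fun ω (k : ℕ × Fin B) => z k.1 k.2 ω) (fun ω n => w n ω) μ)

include h hz hw hzw

theorem memLp_stepVec (n : ℕ) (v : Vec d) (j : Fin d) :
    MemLp (fun ω => stepVec η (w n ω) (fun r => z n r ω) v j) 2 μ :=
  (memLp_const _).sub
    ((memLp_batchSum hz hw hzw (measurable_gramFun v j) (h.memLp_gramFun v j) n).const_mul η)

variable [IsProbabilityMeasure ν]

include hb hB

theorem integral_stepVec_mul (n : ℕ) (v : Vec d) (j k : Fin d) :
    ∫ ω, stepVec η (w n ω) (fun r => z n r ω) v j * stepVec η (w n ω) (fun r => z n r ω) v k ∂μ =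
      stepMoment ν b η v j k := by
  have hg := fun j => memLp_batchSum hz hw hzw (measurable_gramFun v j) (h.memLp_gramFun v j) n
  have hi := fun j => (hg j).integrable (by norm_num : (1 : ENNReal) ≤ 2)
  have hmul := integral_batchSum_mul hz hw hzw hb hB (measurable_gramFun v j)
    (h.memLp_gramFun v j) (measurable_gramFun v k) (h.memLp_gramFun v k) n
  have h1 := fun j => integral_batchSum hz hw hzw (hb.trans hB) (measurable_gramFun v j)
    (h.memLp_gramFun v j) n
  have e : ∀ ω, stepVec η (w n ω) (fun r => z n r ω) v j *
      stepVec η (w n ω) (fun r => z n r ω) v k =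
      v j * v k - η * (v j * batchSum (w n ω) (fun r => z n r ω) (gramFun v k))
        - η * (v k * batchSum (w n ω) (fun r => z n r ω) (gramFun v j))
        + η ^ 2 * (batchSum (w n ω) (fun r => z n r ω) (gramFun v j) *
          batchSum (w n ω) (fun r => z n r ω) (gramFun v k)) := fun ω => by
    simp only [stepVec]; ring
  simp only [e]
  have i1 := ((hi k).const_mul (v j)).const_mul η
  have i2 := ((hi j).const_mul (v k)).const_mul η
  have i3 := (integrable_mul_of_memLp_two (hg j) (hg k)).const_mul (η ^ 2)
  have i0 : Integrable (fun _ : Ω => v j * v k) μ := integrable_const _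
  have i01 : Integrable (fun ω => v j * v k -
      η * (v j * batchSum (w n ω) (fun r => z n r ω) (gramFun v k))) μ := i0.sub i1
  have i012 : Integrable (fun ω => v j * v k -
      η * (v j * batchSum (w n ω) (fun r => z n r ω) (gramFun v k)) -
      η * (v k * batchSum (w n ω) (fun r => z n r ω) (gramFun v j))) μ := i01.sub i2
  rw [integral_add i012 i3, integral_sub i01 i2, integral_sub i0 i1]
  simp only [integral_const_mul, h1, hmul, integral_const, probReal_univ, one_smul, stepMoment]

/-- The step moments form a positive matrix, so that they preserve a bound `N ⪯ K I`. -/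
theorem sum_stepMoment_mul_le {N : Fin d → Fin d → ℝ} {K : ℝ}
    (hN : ∀ a : Fin d → ℝ, ∑ j, ∑ k, a j * a k * N j k ≤ K * ∑ j, a j * a j) (v : Vec d) :
    ∑ j, ∑ k, stepMoment ν b η v j k * N j k ≤ K * ∑ j, stepMoment ν b η v j j := by
  have hm := fun j => memLp_stepVec (η := η) h hz hw hzw 0 v j
  have hi := fun j k => integrable_mul_of_memLp_two (hm j) (hm k)
  simp only [← integral_stepVec_mul h hb hB hz hw hzw 0]
  have e1 : ∑ j, ∑ k, (∫ ω, stepVec η (w 0 ω) (fun r => z 0 r ω) v j *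
      stepVec η (w 0 ω) (fun r => z 0 r ω) v k ∂μ) * N j k =
      ∫ ω, ∑ j, ∑ k, stepVec η (w 0 ω) (fun r => z 0 r ω) v j *
      stepVec η (w 0 ω) (fun r => z 0 r ω) v k * N j k ∂μ := by
    rw [integral_finsetSum _ fun j _ => integrable_finsetSum _ fun k _ => (hi j k).mul_const _]
    refine Finset.sum_congr rfl fun j _ => ?_
    rw [integral_finsetSum _ fun k _ => (hi j k).mul_const _]
    simp only [integral_mul_const]
  rw [e1, ← integral_finsetSum _ fun j _ => hi j j, ← integral_const_mul]
  exact integral_mono (integrable_finsetSum _ fun j _ => integrable_finsetSum _ fun k _ =>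
    (hi j k).mul_const _) ((integrable_finsetSum _ fun j _ => hi j j).const_mul K) fun ω => hN _

end Step

/-! ### The error process -/

/-- The recursion of the errors `θ_n - θ_*`, with the noise scaled by `κ`: the case `κ = 1` is the
algorithm, `κ = 0` its noiseless part. -/
def errorSeq {d B : ℕ} (η κ : ℝ) (ν : Measure (Vec d × ℝ)) (u₀ : Vec d)
    (z : ℕ → Fin B → Vec d × ℝ) (w : ℕ → Fin B → ℝ) : ℕ → Vec d
  | 0 => u₀
  | n + 1 => errorSeq η κ ν u₀ z w n - η • ∑ r, w n r •
      ((inner ℝ (z n r).1 (errorSeq η κ ν u₀ z w n) - κ * residual ν (z n r)) • (z n r).1)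

/-- The error process driven by random samples and weights. -/
def errorProc {d B : ℕ} {Ω : Type*} (η κ : ℝ) (ν : Measure (Vec d × ℝ)) (u₀ : Vec d)
    (z : ℕ → Fin B → Ω → Vec d × ℝ) (w : ℕ → Ω → Fin B → ℝ) (n : ℕ) (ω : Ω) : Vec d :=
  errorSeq η κ ν u₀ (fun k r => z k r ω) (fun k => w k ω) n

/-- The function `ε xᵀ v` of the sample: the noise of the gradient at the optimum. -/
def noiseFun {d : ℕ} (ν : Measure (Vec d × ℝ)) (v : Vec d) (p : Vec d × ℝ) : ℝ :=
  residual ν p * inner ℝ p.1 v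

theorem measurable_noiseFun {d : ℕ} (ν : Measure (Vec d × ℝ)) (v : Vec d) :
    Measurable (noiseFun ν v) :=
  (measurable_residual ν).mul (by fun_prop)

theorem inner_errorSeq_succ {d B : ℕ} (η κ : ℝ) (ν : Measure (Vec d × ℝ)) (u₀ : Vec d)
    (z : ℕ → Fin B → Vec d × ℝ) (w : ℕ → Fin B → ℝ) (n : ℕ) (v : Vec d) :
    inner ℝ v (errorSeq η κ ν u₀ z w (n + 1)) =
      ∑ j, stepVec η (w n) (z n) v j * errorSeq η κ ν u₀ z w n j +
        η * κ * batchSum (w n) (z n) (noiseFun ν v) := by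
  set u := errorSeq η κ ν u₀ z w n with hu
  have h2 : ∑ j, stepVec η (w n) (z n) v j * u j =
      inner ℝ v u - η * ∑ r, w n r * (inner ℝ (z n r).1 v * inner ℝ (z n r).1 u) := by
    simp only [stepVec, batchSum, gramFun, sub_mul, Finset.sum_sub_distrib, real_inner_eq_sum_mul v u]
    congr 1
    simp only [real_inner_eq_sum_mul _ u, Finset.mul_sum, Finset.sum_mul]
    rw [Finset.sum_comm]
    exact Finset.sum_congr rfl fun r _ => Finset.sum_congr rfl fun j _ => by ring
  rw [h2, errorSeq, ← hu, inner_sub_right, real_inner_smul_right, inner_sum, batchSum, sub_add,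
    mul_assoc, ← mul_sub, Finset.mul_sum (a := κ), ← Finset.sum_sub_distrib]
  congr 2
  refine Finset.sum_congr rfl fun r _ => ?_
  rw [real_inner_smul_right, real_inner_smul_right, noiseFun, real_inner_comm v (z n r).1]
  ring

theorem coord_eq_inner {d : ℕ} (v : Vec d) (j : Fin d) :
    v j = inner ℝ (EuclideanSpace.single j (1 : ℝ)) v := by
  simp [EuclideanSpace.inner_single_left]

section ErrorProc

variable {d b B : ℕ} {Ω : Type*} {ν : Measure (Vec d × ℝ)}
  {z : ℕ → Fin B → Ω → Vec d × ℝ} {w : ℕ → Ω → Fin B → ℝ} {R σ lam η κ : ℝ} {u₀ : Vec d}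

theorem inner_errorProc_succ (n : ℕ) (v : Vec d) (ω : Ω) :
    inner ℝ v (errorProc η κ ν u₀ z w (n + 1) ω) =
      ∑ j, stepVec η (w n ω) (fun r => z n r ω) v j * errorProc η κ ν u₀ z w n ω j +
        η * κ * batchSum (w n ω) (fun r => z n r ω) (noiseFun ν v) :=
  inner_errorSeq_succ η κ ν u₀ _ _ n v

theorem measurable_stepVec (n : ℕ) (v : Vec d) (j : Fin d) :
    Measurable[stepSigma z w {n}] fun ω => stepVec η (w n ω) (fun r => z n r ω) v j := by
  have h := measurable_batchSum (F := stepSigma z w {n})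
    (measurable_weight_stepSigma (Set.mem_singleton n))
    (fun r => measurable_sample_stepSigma (Set.mem_singleton n) r) (measurable_gramFun v j)
  exact measurable_const.sub (measurable_const.mul h)

theorem measurable_batch_noiseFun (n : ℕ) (v : Vec d) :
    Measurable[stepSigma z w {n}] fun ω =>
      batchSum (w n ω) (fun r => z n r ω) (noiseFun ν v) :=
  measurable_batchSum (F := stepSigma z w {n})
    (measurable_weight_stepSigma (Set.mem_singleton n))
    (fun r => measurable_sample_stepSigma (Set.mem_singleton n) r) (measurable_noiseFun ν v)

theorem measurable_errorProc (n : ℕ) :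
    Measurable[stepSigma z w (Set.Iio n)] (errorProc η κ ν u₀ z w n) := by
  induction n with
  | zero => exact measurable_const
  | succ n ih =>
    refine (WithLp.measurable_toLp 2 _).comp (f := fun ω => (errorProc η κ ν u₀ z w (n + 1) ω).ofLp)
      ((@measurable_pi_iff Ω (Fin d) (fun _ => ℝ) (stepSigma z w (Set.Iio (n + 1))) _ _).2 fun i => ?_)
    have hu : Measurable[stepSigma z w (Set.Iio (n + 1))] (errorProc η κ ν u₀ z w n) :=
      ih.mono (stepSigma_mono (Set.Iio_subset_Iio n.le_succ)) le_rfl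
    have hn : stepSigma z w {n} ≤ stepSigma z w (Set.Iio (n + 1)) :=
      stepSigma_mono (Set.singleton_subset_iff.2 n.lt_succ_self)
    simp only [coord_eq_inner _ i, inner_errorProc_succ]
    refine (Finset.measurable_sum _ fun j _ => ?_).add (measurable_const.mul
      ((measurable_batch_noiseFun n _).mono hn le_rfl))
    refine ((measurable_stepVec n _ j).mono hn le_rfl).mul ?_
    exact ((measurable_pi_apply j).comp (WithLp.measurable_ofLp 2 _)).comp hu

variable [MeasurableSpace Ω] {μ : Measure Ω} (h : Assumptions ν R σ lam)
  (hz : IsOnlineSample μ ν z) (hw : IsSampling μ b w)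
  (hzw : IndepFun (fun ω (k : ℕ × Fin B) => z k.1 k.2 ω) (fun ω n => w n ω) μ)

include hz hw hzw

theorem indepFun_past_step (n : ℕ) {α β : Type*} [MeasurableSpace α] [MeasurableSpace β]
    {X : Ω → α} {Y : Ω → β} (hX : Measurable[stepSigma z w (Set.Iio n)] X)
    (hY : Measurable[stepSigma z w {n}] Y) : IndepFun X Y μ :=
  indepFun_of_indep (indep_stepSigma hz hw hzw
    (Set.disjoint_singleton_right.2 (by simp))) hX hY

include h

theorem memLp_batch_noiseFun (n : ℕ) (v : Vec d) :
    MemLp (fun ω => batchSum (w n ω) (fun r => z n r ω) (noiseFun ν v)) 2 μ :=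
  memLp_batchSum hz hw hzw (measurable_noiseFun ν v) (h.memLp_noise v) n

variable [IsProbabilityMeasure μ]

theorem memLp_errorProc (n : ℕ) : MemLp (errorProc η κ ν u₀ z w n) 2 μ := by
  induction n with
  | zero => exact memLp_const _
  | succ n ih =>
    refine MemLp.of_eval_piLp fun i => ?_
    simp only [coord_eq_inner _ i, inner_errorProc_succ]
    refine (memLp_finsetSum _ fun j _ => ?_).add ((memLp_batch_noiseFun h hz hw hzw n _).const_mul _)
    have hu : Measurable[stepSigma z w (Set.Iio n)] fun ω => errorProc η κ ν u₀ z w n ω j :=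
      ((measurable_pi_apply j).comp (WithLp.measurable_ofLp 2 _)).comp (measurable_errorProc n)
    exact memLp_two_mul_of_indepFun
      (indepFun_past_step hz hw hzw n hu (measurable_stepVec n _ j)).symm
      (memLp_stepVec h hz hw hzw n _ j) (ih.eval_piLp j)

end ErrorProc

/-! ### Conditional mean and covariance of a step -/

theorem measurable_coord {d : ℕ} {Ω : Type*} {F : MeasurableSpace Ω} {Y : Ω → Vec d} (hY : Measurable[F] Y)
    (j : Fin d) : Measurable[F] fun ω => Y ω j :=
  ((measurable_pi_apply j).comp (WithLp.measurable_ofLp 2 _)).comp hY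

section Recursion

variable {d b B : ℕ} {Ω : Type*} [MeasurableSpace Ω] {μ : Measure Ω} [IsProbabilityMeasure μ]
  {ν : Measure (Vec d × ℝ)} [IsProbabilityMeasure ν]
  {z : ℕ → Fin B → Ω → Vec d × ℝ} {w : ℕ → Ω → Fin B → ℝ} {R σ lam η κ : ℝ} {u₀ : Vec d}
  (h : Assumptions ν R σ lam) (hb : 1 ≤ b) (hB : b ≤ B)
  (hz : IsOnlineSample μ ν z) (hw : IsSampling μ b w)
  (hzw : IndepFun (fun ω (k : ℕ × Fin B) => z k.1 k.2 ω) (fun ω n => w n ω) μ)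

include h hb hB hz hw hzw

theorem integral_stepVec (n : ℕ) (v : Vec d) (j : Fin d) :
    ∫ ω, stepVec η (w n ω) (fun r => z n r ω) v j ∂μ = (v - η • covOp ν v) j := by
  have hi := (memLp_batchSum hz hw hzw (measurable_gramFun v j) (h.memLp_gramFun v j) n).integrable
    (by norm_num : (1 : ENNReal) ≤ 2)
  simp only [stepVec]
  rw [integral_sub (integrable_const _) (hi.const_mul η), integral_const_mul,
    integral_batchSum hz hw hzw (hb.trans hB) (measurable_gramFun v j) (h.memLp_gramFun v j),
    h.integral_gramFun]
  simp

theorem integral_batch_noiseFun (n : ℕ) (v : Vec d) :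
    ∫ ω, batchSum (w n ω) (fun r => z n r ω) (noiseFun ν v) ∂μ = 0 := by
  rw [integral_batchSum hz hw hzw (hb.trans hB) (measurable_noiseFun ν v) (h.memLp_noise v)]
  exact h.integral_residual_mul_inner v

theorem integral_batch_noiseFun_sq_le (n : ℕ) (v : Vec d) :
    ∫ ω, batchSum (w n ω) (fun r => z n r ω) (noiseFun ν v) ^ 2 ∂μ ≤
      σ ^ 2 / b * inner ℝ v (covOp ν v) := by
  have h0 : ∫ p, noiseFun ν v p ∂ν = 0 := h.integral_residual_mul_inner v
  have h1 := h.integral_residual_sq_mul_le v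
  simp only [sq (batchSum _ _ _)]
  rw [integral_batchSum_mul hz hw hzw hb hB (measurable_noiseFun ν v) (h.memLp_noise v)
    (measurable_noiseFun ν v) (h.memLp_noise v), h0]
  have h2 : ∫ p, noiseFun ν v p * noiseFun ν v p ∂ν ≤ σ ^ 2 * inner ℝ v (covOp ν v) := by
    simpa only [noiseFun, ← sq] using h1
  calc _ = 1 / (b : ℝ) * ∫ p, noiseFun ν v p * noiseFun ν v p ∂ν := by ring
    _ ≤ 1 / (b : ℝ) * (σ ^ 2 * inner ℝ v (covOp ν v)) := by gcongr
    _ = _ := by ring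

/-- Conditionally on the past, a step applies `I - η Σ` to the error. -/
theorem integral_inner_errorProc_succ (n : ℕ) {Y : Ω → Vec d}
    (hYm : Measurable[stepSigma z w (Set.Iio n)] Y) (hY : MemLp Y 2 μ) :
    ∫ ω, inner ℝ (Y ω) (errorProc η κ ν u₀ z w (n + 1) ω) ∂μ =
      ∫ ω, inner ℝ (Y ω) (errorProc η κ ν u₀ z w n ω - η • covOp ν (errorProc η κ ν u₀ z w n ω))
        ∂μ := by
  set u := errorProc η κ ν u₀ z w n with hu
  set a : Fin d → Fin d → Ω → ℝ := fun i j ω =>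
    stepVec η (w n ω) (fun r => z n r ω) (EuclideanSpace.single i 1) j with ha
  set N : Fin d → Ω → ℝ := fun i ω =>
    batchSum (w n ω) (fun r => z n r ω) (noiseFun ν (EuclideanSpace.single i 1)) with hN
  have hYu : ∀ i j, Integrable (fun ω => Y ω i * u ω j) μ := fun i j =>
    integrable_mul_of_memLp_two (hY.eval_piLp i) ((memLp_errorProc h hz hw hzw n).eval_piLp j)
  have hai : ∀ i j, Integrable (a i j) μ := fun i j =>
    (memLp_stepVec h hz hw hzw n _ j).integrable (by norm_num)
  have hNi : ∀ i, Integrable (N i) μ := fun i =>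
    (memLp_batch_noiseFun h hz hw hzw n _).integrable (by norm_num)
  have hYi : ∀ i, Integrable (fun ω => Y ω i) μ := fun i =>
    (hY.eval_piLp i).integrable (by norm_num)
  have ind1 : ∀ i j, IndepFun (fun ω => Y ω i * u ω j) (a i j) μ := fun i j =>
    indepFun_past_step hz hw hzw n
      ((measurable_coord hYm i).mul (measurable_coord (measurable_errorProc n) j))
      (measurable_stepVec n _ j)
  have ind2 : ∀ i, IndepFun (fun ω => Y ω i) (N i) μ := fun i =>
    indepFun_past_step hz hw hzw n (measurable_coord hYm i) (measurable_batch_noiseFun n _)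
  have hl : ∀ ω, inner ℝ (Y ω) (errorProc η κ ν u₀ z w (n + 1) ω) =
      ∑ i, (∑ j, Y ω i * u ω j * a i j ω + η * κ * (Y ω i * N i ω)) := fun ω => by
    rw [real_inner_eq_sum_mul]
    refine Finset.sum_congr rfl fun i _ => ?_
    rw [coord_eq_inner (errorProc η κ ν u₀ z w (n + 1) ω) i, inner_errorProc_succ, mul_add,
      Finset.mul_sum]
    congr 1
    · exact Finset.sum_congr rfl fun j _ => by simp only [ha, hu]; ring
    · simp only [hN]; ring
  have hr : ∀ ω, inner ℝ (Y ω) (u ω - η • covOp ν (u ω)) =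
      ∑ i, ∑ j, Y ω i * u ω j *
        ((EuclideanSpace.single i (1 : ℝ) : Vec d) - η • covOp ν (EuclideanSpace.single i 1)) j :=
    fun ω => by
    have hs : ∀ i, (u ω - η • covOp ν (u ω)) i = inner ℝ
        ((EuclideanSpace.single i (1 : ℝ) : Vec d) - η • covOp ν (EuclideanSpace.single i 1))
        (u ω) := fun i => by
      rw [coord_eq_inner, h.inner_sub_covOp_comm]
    rw [real_inner_eq_sum_mul]
    simp only [hs]
    simp only [real_inner_eq_sum_mul, Finset.mul_sum]
    exact Finset.sum_congr rfl fun i _ => Finset.sum_congr rfl fun j _ => by ring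
  have t1 : ∀ i j, Integrable (fun ω => Y ω i * u ω j * a i j ω) μ := fun i j =>
    (ind1 i j).integrable_mul (hYu i j) (hai i j)
  have t2 : ∀ i, Integrable (fun ω => η * κ * (Y ω i * N i ω)) μ := fun i =>
    ((ind2 i).integrable_mul (hYi i) (hNi i)).const_mul _
  have e1 : ∀ i j, ∫ ω, Y ω i * u ω j * a i j ω ∂μ = (∫ ω, Y ω i * u ω j ∂μ) *
      ((EuclideanSpace.single i (1 : ℝ) : Vec d) - η • covOp ν (EuclideanSpace.single i 1)) j :=
    fun i j => by
    rw [(ind1 i j).integral_fun_mul_eq_mul_integral (hYu i j).aestronglyMeasurable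
      (hai i j).aestronglyMeasurable, ← integral_stepVec h hb hB hz hw hzw n]
  have e2 : ∀ i, ∫ ω, Y ω i * N i ω ∂μ = 0 := fun i => by
    rw [(ind2 i).integral_fun_mul_eq_mul_integral (hYi i).aestronglyMeasurable
      (hNi i).aestronglyMeasurable, integral_batch_noiseFun h hb hB hz hw hzw n, mul_zero]
  have t12 : ∀ i, Integrable (fun ω => ∑ j, Y ω i * u ω j * a i j ω + η * κ * (Y ω i * N i ω)) μ :=
    fun i => (integrable_finsetSum _ fun j _ => t1 i j).add (t2 i)
  simp only [hl, hr]
  rw [integral_finsetSum _ fun i _ => t12 i,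
    integral_finsetSum _ fun i _ => integrable_finsetSum _ fun j _ => (hYu i j).mul_const _]
  refine Finset.sum_congr rfl fun i _ => ?_
  rw [integral_add (integrable_finsetSum _ fun j _ => t1 i j) (t2 i),
    integral_finsetSum _ fun j _ => t1 i j, integral_finsetSum _ fun j _ => (hYu i j).mul_const _,
    integral_const_mul, e2, mul_zero, add_zero]
  simp only [e1, integral_mul_const]

/-- The error process started at the optimum has mean zero. -/
theorem integral_inner_errorProc_zero (n : ℕ) (v : Vec d) :
    ∫ ω, inner ℝ v (errorProc η κ ν 0 z w n ω) ∂μ = 0 := by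
  induction n generalizing v with
  | zero => simp [errorProc, errorSeq]
  | succ n ih =>
    rw [integral_inner_errorProc_succ h hb hB hz hw hzw n (Y := fun _ => v) measurable_const
      (memLp_const _), ← ih (v - η • covOp ν v)]
    refine integral_congr_ae (Filter.Eventually.of_forall fun ω => ?_)
    exact h.inner_sub_covOp_comm _ _

/-- The recursion of the covariance of the error process. The cross term between error and noise
vanishes if there is no noise or if the error has mean zero. -/
theorem integral_inner_sq_errorProc_succ_le (hκ : κ = 0 ∨ u₀ = 0) (n : ℕ) (v : Vec d) :
    ∫ ω, inner ℝ v (errorProc η κ ν u₀ z w (n + 1) ω) ^ 2 ∂μ ≤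
      ∑ j, ∑ k, stepMoment ν b η v j k *
        (∫ ω, errorProc η κ ν u₀ z w n ω j * errorProc η κ ν u₀ z w n ω k ∂μ) +
      η ^ 2 * κ ^ 2 * (σ ^ 2 / b * inner ℝ v (covOp ν v)) := by
  set u := errorProc η κ ν u₀ z w n with hu
  set a : Fin d → Ω → ℝ := fun j ω => stepVec η (w n ω) (fun r => z n r ω) v j with ha
  set N : Ω → ℝ := fun ω => batchSum (w n ω) (fun r => z n r ω) (noiseFun ν v) with hN
  have hum : ∀ j, MemLp (fun ω => u ω j) 2 μ := fun j =>
    (memLp_errorProc h hz hw hzw n).eval_piLp j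
  have ham : ∀ j, MemLp (a j) 2 μ := fun j => memLp_stepVec h hz hw hzw n v j
  have hNm : MemLp N 2 μ := memLp_batch_noiseFun h hz hw hzw n v
  have huu := fun j k => integrable_mul_of_memLp_two (hum j) (hum k)
  have haa := fun j k => integrable_mul_of_memLp_two (ham j) (ham k)
  have haN := fun j => integrable_mul_of_memLp_two (ham j) hNm
  have hui : ∀ j, Integrable (fun ω => u ω j) μ := fun j => (hum j).integrable (by norm_num)
  have mu := fun j => measurable_coord (measurable_errorProc (η := η) (κ := κ) (ν := ν) (u₀ := u₀)
    (z := z) (w := w) n) j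
  have ma := fun j => measurable_stepVec (η := η) (z := z) (w := w) n v j
  have mN := measurable_batch_noiseFun (ν := ν) (z := z) (w := w) n v
  have ind1 : ∀ j k, IndepFun (fun ω => a j ω * a k ω) (fun ω => u ω j * u ω k) μ := fun j k =>
    (indepFun_past_step hz hw hzw n ((mu j).mul (mu k)) ((ma j).mul (ma k))).symm
  have ind2 : ∀ j, IndepFun (fun ω => a j ω * N ω) (fun ω => u ω j) μ := fun j =>
    (indepFun_past_step hz hw hzw n (mu j) ((ma j).mul mN)).symm
  have e : ∀ ω, inner ℝ v (errorProc η κ ν u₀ z w (n + 1) ω) ^ 2 =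
      ∑ j, ∑ k, a j ω * a k ω * (u ω j * u ω k) + ∑ j, 2 * η * (κ * (a j ω * N ω * u ω j)) +
        η ^ 2 * κ ^ 2 * N ω ^ 2 := fun ω => by
    rw [inner_errorProc_succ, add_sq, sq (∑ j, _), Finset.sum_mul_sum]
    congr 2
    · exact Finset.sum_congr rfl fun j _ => Finset.sum_congr rfl fun k _ => by
        simp only [ha, hu]; ring
    · rw [Finset.mul_sum, Finset.sum_mul]
      exact Finset.sum_congr rfl fun j _ => by simp only [ha, hu, hN]; ring
    · ring
  have t1 : ∀ j k, Integrable (fun ω => a j ω * a k ω * (u ω j * u ω k)) μ := fun j k =>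
    (ind1 j k).integrable_mul (haa j k) (huu j k)
  have t2' : ∀ j, Integrable (fun ω => a j ω * N ω * u ω j) μ := fun j =>
    (ind2 j).integrable_mul (haN j) (hui j)
  have t2 : ∀ j, Integrable (fun ω => 2 * η * (κ * (a j ω * N ω * u ω j))) μ := fun j =>
    ((t2' j).const_mul κ).const_mul _
  have t3 : Integrable (fun ω => η ^ 2 * κ ^ 2 * N ω ^ 2) μ := hNm.integrable_sq.const_mul _
  have hmean : ∀ j, κ * ∫ ω, u ω j ∂μ = 0 := fun j => by
    rcases hκ with rfl | rfl
    · exact zero_mul _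
    · simp only [coord_eq_inner _ j]
      rw [integral_inner_errorProc_zero h hb hB hz hw hzw, mul_zero]
  have e1 : ∀ j k, ∫ ω, a j ω * a k ω * (u ω j * u ω k) ∂μ =
      stepMoment ν b η v j k * ∫ ω, u ω j * u ω k ∂μ := fun j k => by
    rw [(ind1 j k).integral_fun_mul_eq_mul_integral (haa j k).aestronglyMeasurable
      (huu j k).aestronglyMeasurable, integral_stepVec_mul h hb hB hz hw hzw]
  have e2 : ∀ j, ∫ ω, 2 * η * (κ * (a j ω * N ω * u ω j)) ∂μ = 0 := fun j => by
    rw [integral_const_mul, integral_const_mul, (ind2 j).integral_fun_mul_eq_mul_integral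
      (haN j).aestronglyMeasurable (hui j).aestronglyMeasurable, mul_left_comm κ, hmean]
    ring
  have s1 := integrable_finsetSum Finset.univ fun j _ =>
    integrable_finsetSum Finset.univ fun k _ => t1 j k
  have s2 := integrable_finsetSum Finset.univ fun j _ => t2 j
  have s12 : Integrable (fun ω => ∑ j, ∑ k, a j ω * a k ω * (u ω j * u ω k) +
    ∑ j, 2 * η * (κ * (a j ω * N ω * u ω j))) μ := s1.add s2
  simp only [e]
  rw [integral_add s12 t3, integral_add s1 s2, integral_const_mul,
    integral_finsetSum _ fun j _ => integrable_finsetSum _ fun k _ => t1 j k,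
    integral_finsetSum _ fun j _ => t2 j]
  simp only [integral_finsetSum _ fun k _ => t1 _ k, e1, e2, Finset.sum_const_zero, add_zero]
  gcongr
  exact integral_batch_noiseFun_sq_le h hb hB hz hw hzw n v

end Recursion

/-! ### Bounds on the covariance of the error -/

section L2

variable {d : ℕ} {Ω : Type*} [MeasurableSpace Ω] {μ : Measure Ω}

theorem integrable_inner_of_memLp_two {X Y : Ω → Vec d} (hX : MemLp X 2 μ) (hY : MemLp Y 2 μ) :
    Integrable (fun ω => (inner ℝ (X ω) (Y ω) : ℝ)) μ := by
  simp only [real_inner_eq_sum_mul]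
  exact integrable_finsetSum _ fun j _ =>
    integrable_mul_of_memLp_two (hX.eval_piLp j) (hY.eval_piLp j)

theorem memLp_linearMap_comp (T : Vec d →ₗ[ℝ] Vec d) {X : Ω → Vec d} (hX : MemLp X 2 μ) :
    MemLp (fun ω => T (X ω)) 2 μ :=
  (LinearMap.toContinuousLinearMap T).comp_memLp' hX

theorem sum_mul_integral_coord_mul {X : Ω → Vec d} (hX : MemLp X 2 μ) (v : Vec d) :
    ∑ j, ∑ k, v j * v k * (∫ ω, X ω j * X ω k ∂μ) = ∫ ω, inner ℝ v (X ω) ^ 2 ∂μ := by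
  have hi : ∀ j k, Integrable (fun ω => v j * v k * (X ω j * X ω k)) μ := fun j k =>
    (integrable_mul_of_memLp_two (hX.eval_piLp j) (hX.eval_piLp k)).const_mul _
  have e : ∀ ω, inner ℝ v (X ω) ^ 2 = ∑ j, ∑ k, v j * v k * (X ω j * X ω k) := fun ω => by
    rw [real_inner_eq_sum_mul, sq, Finset.sum_mul_sum]
    exact Finset.sum_congr rfl fun j _ => Finset.sum_congr rfl fun k _ => by ring
  simp only [e]
  rw [integral_finsetSum _ fun j _ => integrable_finsetSum _ fun k _ => hi j k]
  simp only [integral_finsetSum _ fun k _ => hi _ k, integral_const_mul]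

theorem integral_norm_sq_eq_sum {X : Ω → Vec d} (hX : MemLp X 2 μ) :
    ∫ ω, ‖X ω‖ ^ 2 ∂μ = ∑ j, ∫ ω, inner ℝ (EuclideanSpace.single j (1 : ℝ)) (X ω) ^ 2 ∂μ := by
  simp only [← coord_eq_inner, EuclideanSpace.real_norm_sq_eq]
  exact integral_finsetSum _ fun j _ => (hX.eval_piLp j).integrable_sq

end L2

/-- The contraction margin `γ = 2 - η (R² + (b - 1) λ) / b` of a step. -/
def stepMargin (b : ℕ) (η R lam : ℝ) : ℝ := 2 - η * ((R ^ 2 + ((b : ℝ) - 1) * lam) / b)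

section Bounds

variable {d b B : ℕ} {Ω : Type*} [MeasurableSpace Ω] {μ : Measure Ω} [IsProbabilityMeasure μ]
  {ν : Measure (Vec d × ℝ)} [IsProbabilityMeasure ν]
  {z : ℕ → Fin B → Ω → Vec d × ℝ} {w : ℕ → Ω → Fin B → ℝ} {R σ lam η κ : ℝ} {u₀ : Vec d}
  (h : Assumptions ν R σ lam) (hb : 1 ≤ b) (hB : b ≤ B) (hη : 0 < η)
  (hstep : η * ((R ^ 2 + ((b : ℝ) - 1) * lam) / b) < 2)
  (hz : IsOnlineSample μ ν z) (hw : IsSampling μ b w)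
  (hzw : IndepFun (fun ω (k : ℕ × Fin B) => z k.1 k.2 ω) (fun ω n => w n ω) μ)

include h hb hB hη hstep hz hw hzw

/-- Without initial error, the covariance of the error stays below the multiple of the identity
at which the contraction of a step balances the injected noise. -/
theorem integral_inner_sq_noisy_le (n : ℕ) (v : Vec d) :
    ∫ ω, inner ℝ v (errorProc η 1 ν 0 z w n ω) ^ 2 ∂μ ≤
      η * σ ^ 2 / (b * stepMargin b η R lam) * ‖v‖ ^ 2 := by
  have hγ : 0 < stepMargin b η R lam := sub_pos.2 hstep
  have hb0 : (0 : ℝ) < b := by positivity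
  have hC : 0 ≤ η * σ ^ 2 / (b * stepMargin b η R lam) := by positivity
  set C := η * σ ^ 2 / (b * stepMargin b η R lam) with hCdef
  have hCγ : C * (η * stepMargin b η R lam) = η ^ 2 * (σ ^ 2 / b) := by
    rw [hCdef]; field_simp
  induction n generalizing v with
  | zero => simpa [errorProc, errorSeq] using mul_nonneg hC (sq_nonneg ‖v‖)
  | succ n ih =>
    have h1 := integral_inner_sq_errorProc_succ_le (κ := 1) (u₀ := 0) (η := η) h hb hB hz hw hzw
      (Or.inr rfl) n v
    have h2 := sum_stepMoment_mul_le (η := η) h hb hB hz hw hzw (K := C)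
      (N := fun j k => ∫ ω, errorProc η 1 ν 0 z w n ω j * errorProc η 1 ν 0 z w n ω k ∂μ)
      (fun a => by
        have := ih (WithLp.toLp 2 a)
        rwa [← sum_mul_integral_coord_mul (memLp_errorProc h hz hw hzw n),
          norm_sq_eq_sum_mul] at this) v
    have h3 := mul_le_mul_of_nonneg_left (h.sum_stepMoment_le (η := η) hb v) hC
    rw [← stepMargin, mul_sub, ← mul_assoc C (η * _), hCγ] at h3
    linarith

/-- Without noise, if the outer product of the initial error is at most `g Σ`, then the
covariances of all errors together stay below a multiple of the identity: `Σ` is at most the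
decrease of the identity under one step, divided by `η γ`, and the decreases telescope. -/
theorem sum_integral_inner_sq_noiseless_le {g : ℝ} (hg : 0 ≤ g)
    (hu₀ : ∀ v : Vec d, inner ℝ v u₀ ^ 2 ≤ g * inner ℝ v (covOp ν v)) (n : ℕ) (v : Vec d) :
    ∑ i ∈ Finset.range n, ∫ ω, inner ℝ v (errorProc η 0 ν u₀ z w i ω) ^ 2 ∂μ ≤
      g / (η * stepMargin b η R lam) * ‖v‖ ^ 2 := by
  have hγ : 0 < stepMargin b η R lam := sub_pos.2 hstep
  have hC : 0 ≤ g / (η * stepMargin b η R lam) := by positivity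
  set C := g / (η * stepMargin b η R lam) with hCdef
  have hCγ : C * (η * stepMargin b η R lam) = g := by
    rw [hCdef]; field_simp
  induction n generalizing v with
  | zero => simpa using mul_nonneg hC (sq_nonneg ‖v‖)
  | succ n ih =>
    have h1 := fun i => integral_inner_sq_errorProc_succ_le (κ := 0) (u₀ := u₀) (η := η)
      h hb hB hz hw hzw (Or.inl rfl) i v
    have h2 := sum_stepMoment_mul_le (η := η) h hb hB hz hw hzw (K := C)
      (N := fun j k => ∑ i ∈ Finset.range n,
        ∫ ω, errorProc η 0 ν u₀ z w i ω j * errorProc η 0 ν u₀ z w i ω k ∂μ)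
      (fun a => by
        have := ih (WithLp.toLp 2 a)
        simp only [← sum_mul_integral_coord_mul (memLp_errorProc h hz hw hzw _),
          norm_sq_eq_sum_mul] at this
        rw [Finset.sum_comm] at this
        simp only [Finset.sum_comm (s := Finset.range n), ← Finset.mul_sum] at this
        exact this) v
    have h3 := mul_le_mul_of_nonneg_left (h.sum_stepMoment_le (η := η) hb v) hC
    rw [← stepMargin, mul_sub, ← mul_assoc C (η * _), hCγ] at h3
    have h4 : ∑ i ∈ Finset.range n, ∫ ω, inner ℝ v (errorProc η 0 ν u₀ z w (i + 1) ω) ^ 2 ∂μ ≤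
        ∑ j, ∑ k, stepMoment ν b η v j k * ∑ i ∈ Finset.range n,
          ∫ ω, errorProc η 0 ν u₀ z w i ω j * errorProc η 0 ν u₀ z w i ω k ∂μ := by
      refine (Finset.sum_le_sum fun i _ => h1 i).trans (le_of_eq ?_)
      simp only [ne_eq, OfNat.ofNat_ne_zero, not_false_eq_true, zero_pow, mul_zero, zero_mul,
        add_zero, Finset.mul_sum]
      rw [Finset.sum_comm]
      exact Finset.sum_congr rfl fun j _ => Finset.sum_comm
    have h5 : ∫ ω, inner ℝ v (errorProc η 0 ν u₀ z w 0 ω) ^ 2 ∂μ ≤ g * inner ℝ v (covOp ν v) := by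
      simpa [errorProc, errorSeq] using hu₀ v
    rw [Finset.sum_range_succ']
    linarith

theorem sum_integral_norm_sq_noisy_le (n : ℕ) :
    ∑ i ∈ Finset.range n, ∫ ω, ‖errorProc η 1 ν 0 z w i ω‖ ^ 2 ∂μ ≤
      n * (d * (η * σ ^ 2 / (b * stepMargin b η R lam))) := by
  have hsum : ∀ i ∈ Finset.range n, ∫ ω, ‖errorProc η 1 ν 0 z w i ω‖ ^ 2 ∂μ ≤
      d * (η * σ ^ 2 / (b * stepMargin b η R lam)) := fun i _ => by
    rw [integral_norm_sq_eq_sum (memLp_errorProc h hz hw hzw i)]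
    refine (Finset.sum_le_sum fun j _ =>
      integral_inner_sq_noisy_le h hb hB hη hstep hz hw hzw i _).trans (le_of_eq ?_)
    simp
  simpa using Finset.sum_le_card_nsmul _ _ _ hsum

theorem sum_integral_norm_sq_noiseless_le {g : ℝ} (hg : 0 ≤ g)
    (hu₀ : ∀ v : Vec d, inner ℝ v u₀ ^ 2 ≤ g * inner ℝ v (covOp ν v)) (n : ℕ) :
    ∑ i ∈ Finset.range n, ∫ ω, ‖errorProc η 0 ν u₀ z w i ω‖ ^ 2 ∂μ ≤
      d * (g / (η * stepMargin b η R lam)) := by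
  simp only [integral_norm_sq_eq_sum (memLp_errorProc h hz hw hzw _)]
  rw [Finset.sum_comm]
  refine (Finset.sum_le_sum fun j _ => sum_integral_inner_sq_noiseless_le h hb hB hη hstep hz hw
    hzw hg hu₀ n _).trans (le_of_eq ?_)
  simp

/-! ### The averaged error -/

/-- Later errors correlate with past quantities through powers of the contraction `I - η Σ`, which
are absorbed into `Y`; this bounds the boundary term of the telescoping sum below. -/
theorem neg_integral_inner_errorProc_le (i k : ℕ) {Y : Ω → Vec d}
    (hYm : Measurable[stepSigma z w (Set.Iio i)] Y) (hY : MemLp Y 2 μ)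
    (hYu : ∀ ω, ‖Y ω‖ ≤ ‖errorProc η κ ν u₀ z w i ω‖) :
    -∫ ω, inner ℝ (Y ω) (errorProc η κ ν u₀ z w (i + k) ω) ∂μ ≤
      ∫ ω, ‖errorProc η κ ν u₀ z w i ω‖ ^ 2 ∂μ := by
  induction k generalizing Y with
  | zero =>
    have hu := memLp_errorProc (η := η) (κ := κ) (u₀ := u₀) h hz hw hzw i
    rw [← integral_neg]
    refine integral_mono (integrable_inner_of_memLp_two hY hu).neg hu.norm.integrable_sq fun ω => ?_
    have h1 := neg_le_of_abs_le (abs_real_inner_le_norm (Y ω) (errorProc η κ ν u₀ z w i ω))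
    have h2 := mul_le_mul_of_nonneg_right (hYu ω) (norm_nonneg (errorProc η κ ν u₀ z w i ω))
    simp only [add_zero]
    nlinarith
  | succ k ih =>
    set A : Vec d →ₗ[ℝ] Vec d := LinearMap.id - η • covOp ν with hA
    have hAm : Measurable A := A.continuous_of_finiteDimensional.measurable
    have hAv : ∀ v, A v = v - η • covOp ν v := fun v => rfl
    have := ih (Y := fun ω => A (Y ω)) (hAm.comp hYm) (memLp_linearMap_comp A hY) fun ω => by
      refine le_trans ?_ (hYu ω)
      exact le_of_sq_le_sq (h.norm_sub_covOp_le hb hη hstep _) (norm_nonneg _)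
    refine le_of_eq_of_le ?_ this
    rw [← add_assoc, integral_inner_errorProc_succ h hb hB hz hw hzw (i + k)
      (hYm.mono (stepSigma_mono (Set.Iio_subset_Iio (i.le_add_right k))) le_rfl) hY]
    simp only [hAv, h.inner_sub_covOp_comm]

/-- The energy of the summed errors is at most a multiple of the summed energies. Each step
replaces `u` by `u - η Σ u` on average, so that `η E⟨s, Σ u⟩` telescopes. -/
theorem integral_inner_covOp_sum_le (n : ℕ) :
    ∫ ω, inner ℝ (∑ i ∈ Finset.range n, errorProc η κ ν u₀ z w i ω)
        (covOp ν (∑ i ∈ Finset.range n, errorProc η κ ν u₀ z w i ω)) ∂μ ≤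
      4 / η * ∑ i ∈ Finset.range n, ∫ ω, ‖errorProc η κ ν u₀ z w i ω‖ ^ 2 ∂μ := by
  set u := errorProc η κ ν u₀ z w with hu
  set s : ℕ → Ω → Vec d := fun n ω => ∑ i ∈ Finset.range n, u i ω with hs
  have hum : ∀ n, MemLp (u n) 2 μ := fun n => memLp_errorProc h hz hw hzw n
  have hsm : ∀ n, MemLp (s n) 2 μ := fun n => memLp_finsetSum _ fun i _ => hum i
  have hmeas : ∀ i n, i ≤ n → Measurable[stepSigma z w (Set.Iio n)] (u i) := fun i n hin =>
    (measurable_errorProc i).mono (stepSigma_mono (Set.Iio_subset_Iio hin)) le_rfl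
  have hsucc : ∀ n ω, s (n + 1) ω = s n ω + u n ω := fun n ω => Finset.sum_range_succ _ _
  have hint := fun {X Y : Ω → Vec d} (hX : MemLp X 2 μ) (hY : MemLp Y 2 μ) =>
    integrable_inner_of_memLp_two hX hY
  have hcov := fun {X : Ω → Vec d} (hX : MemLp X 2 μ) => memLp_linearMap_comp (covOp ν) hX
  have key : ∀ n, ∫ ω, inner ℝ (s n ω) (covOp ν (s n ω)) ∂μ ≤
      2 / η * (∑ i ∈ Finset.range n, ∫ ω, ‖u i ω‖ ^ 2 ∂μ - ∫ ω, inner ℝ (s n ω) (u n ω) ∂μ) := by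
    intro n
    induction n with
    | zero => simp [hs]
    | succ n ih =>
      have e1 : ∫ ω, inner ℝ (s (n + 1) ω) (covOp ν (s (n + 1) ω)) ∂μ =
          ∫ ω, inner ℝ (s n ω) (covOp ν (s n ω)) ∂μ +
            2 * ∫ ω, inner ℝ (s (n + 1) ω) (covOp ν (u n ω)) ∂μ -
            ∫ ω, inner ℝ (u n ω) (covOp ν (u n ω)) ∂μ := by
        have i1 := hint (hsm n) (hcov (hsm n))
        have i2 := (hint (hsm (n + 1)) (hcov (hum n))).const_mul 2
        have i3 := hint (hum n) (hcov (hum n))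
        have i12 : Integrable (fun ω => inner ℝ (s n ω) (covOp ν (s n ω)) +
            2 * inner ℝ (s (n + 1) ω) (covOp ν (u n ω))) μ := i1.add i2
        rw [← integral_const_mul, ← integral_add i1 i2, ← integral_sub i12 i3]
        refine integral_congr_ae (Filter.Eventually.of_forall fun ω => ?_)
        simp only [hsucc, map_add, inner_add_left, inner_add_right]
        rw [h.inner_covOp_comm (u n ω) (s n ω)]
        ring
      have e2 : ∫ ω, inner ℝ (s (n + 1) ω) (u (n + 1) ω) ∂μ =
          ∫ ω, inner ℝ (s n ω) (u n ω) ∂μ + ∫ ω, ‖u n ω‖ ^ 2 ∂μ -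
            η * ∫ ω, inner ℝ (s (n + 1) ω) (covOp ν (u n ω)) ∂μ := by
        have i1 := hint (hsm n) (hum n)
        have i2 := (hum n).norm.integrable_sq
        have i3 := (hint (hsm (n + 1)) (hcov (hum n))).const_mul η
        have i12 : Integrable (fun ω => inner ℝ (s n ω) (u n ω) + ‖u n ω‖ ^ 2) μ := i1.add i2
        have hsM : Measurable[stepSigma z w (Set.Iio n)] (s (n + 1)) :=
          Finset.measurable_sum _ fun i hi => hmeas i n (Nat.lt_succ_iff.1 (Finset.mem_range.1 hi))
        rw [integral_inner_errorProc_succ h hb hB hz hw hzw n hsM (hsm (n + 1)), ← integral_const_mul, ← integral_add i1 i2, ← integral_sub i12 i3]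
        refine integral_congr_ae (Filter.Eventually.of_forall fun ω => ?_)
        simp only [← hu, inner_sub_right, real_inner_smul_right, hsucc, inner_add_left,
          real_inner_self_eq_norm_sq]
        ring
      have e3 : 0 ≤ ∫ ω, inner ℝ (u n ω) (covOp ν (u n ω)) ∂μ :=
        integral_nonneg fun ω => h.inner_covOp_self_nonneg _
      rw [e1, e2, Finset.sum_range_succ]
      have e4 : 2 / η * (∑ i ∈ Finset.range n, ∫ ω, ‖u i ω‖ ^ 2 ∂μ + ∫ ω, ‖u n ω‖ ^ 2 ∂μ -
          (∫ ω, inner ℝ (s n ω) (u n ω) ∂μ + ∫ ω, ‖u n ω‖ ^ 2 ∂μ -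
            η * ∫ ω, inner ℝ (s (n + 1) ω) (covOp ν (u n ω)) ∂μ)) =
          2 / η * (∑ i ∈ Finset.range n, ∫ ω, ‖u i ω‖ ^ 2 ∂μ - ∫ ω, inner ℝ (s n ω) (u n ω) ∂μ) +
            2 * ∫ ω, inner ℝ (s (n + 1) ω) (covOp ν (u n ω)) ∂μ := by
        field_simp
        ring
      linarith
  have hbd : -∫ ω, inner ℝ (s n ω) (u n ω) ∂μ ≤ ∑ i ∈ Finset.range n, ∫ ω, ‖u i ω‖ ^ 2 ∂μ := by
    simp only [hs, sum_inner]
    rw [integral_finsetSum _ fun i _ => hint (hum i) (hum n), ← Finset.sum_neg_distrib]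
    refine Finset.sum_le_sum fun i hi => ?_
    have := neg_integral_inner_errorProc_le h hb hB hη hstep hz hw hzw i (n - i)
      (measurable_errorProc i) (hum i) fun ω => le_rfl
    rwa [Nat.add_sub_cancel' (Finset.mem_range.1 hi).le] at this
  calc _ ≤ _ := key n
    _ ≤ 2 / η * (∑ i ∈ Finset.range n, ∫ ω, ‖u i ω‖ ^ 2 ∂μ +
        ∑ i ∈ Finset.range n, ∫ ω, ‖u i ω‖ ^ 2 ∂μ) := by
      refine mul_le_mul_of_nonneg_left ?_ (by positivity)
      linarith
    _ = _ := by ring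

end Bounds

/-! ### The two algorithms -/

theorem msgd_sub_optimum {d B : ℕ} (η : ℝ) (ν : Measure (Vec d × ℝ)) (θ₀ : Vec d)
    (z : ℕ → Fin B → Vec d × ℝ) (w : ℕ → Fin B → ℝ) (n : ℕ) :
    msgd η θ₀ z w n - optimum ν = errorSeq η 1 ν (θ₀ - optimum ν) z w n := by
  induction n with
  | zero => rfl
  | succ n ih =>
    rw [msgd, errorSeq, ← ih, sub_right_comm]
    have e : ∀ r, sampleGrad (z n r) (msgd η θ₀ z w n) =
        (inner ℝ (z n r).1 (msgd η θ₀ z w n - optimum ν) - 1 * residual ν (z n r)) • (z n r).1 :=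
      fun r => by
        rw [sampleGrad, residual, inner_sub_right, one_mul, sub_sub_sub_cancel_right]
    simp only [e]

/-- The error splits into a constant part orthogonal to all features, a part that starts at the
optimum and carries the noise, and a noiseless part. -/
theorem errorSeq_add {d B : ℕ} (η : ℝ) (ν : Measure (Vec d × ℝ)) (k u : Vec d)
    (z : ℕ → Fin B → Vec d × ℝ) (w : ℕ → Fin B → ℝ) (hk : ∀ n r, inner ℝ (z n r).1 k = (0 : ℝ))
    (n : ℕ) : errorSeq η 1 ν (k + u) z w n =
      k + (errorSeq η 1 ν 0 z w n + errorSeq η 0 ν u z w n) := by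
  induction n with
  | zero => simp [errorSeq]
  | succ n ih =>
    simp only [errorSeq, ih]
    set a := errorSeq η 1 ν 0 z w n
    set c := errorSeq η 0 ν u z w n
    have : ∀ r, w n r • ((inner ℝ (z n r).1 (k + (a + c)) - 1 * residual ν (z n r)) • (z n r).1) =
        w n r • ((inner ℝ (z n r).1 a - 1 * residual ν (z n r)) • (z n r).1) +
        w n r • ((inner ℝ (z n r).1 c - 0 * residual ν (z n r)) • (z n r).1) := fun r => by
      rw [inner_add_right, inner_add_right, hk]
      module
    simp only [this, Finset.sum_add_distrib]
    module

theorem average_sub {d : ℕ} (θ : ℕ → Vec d) (c : Vec d) (n : ℕ) :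
    average θ n - c = (1 / ((n : ℝ) + 1)) • ∑ i ∈ Finset.range (n + 1), (θ i - c) := by
  have hn : ((n : ℝ) + 1) ≠ 0 := by positivity
  rw [average, Finset.sum_sub_distrib, smul_sub, Finset.sum_const, Finset.card_range,
    ← Nat.cast_smul_eq_nsmul ℝ, smul_smul]
  push_cast
  rw [one_div_mul_cancel hn, one_smul]

theorem sgd_eq_msgd {d b : ℕ} (η : ℝ) (θ₀ : Vec d) (z : ℕ → Fin b → Vec d × ℝ) :
    sgd η θ₀ z = msgd η θ₀ z fun _ _ => 1 / (b : ℝ) := by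
  funext n
  induction n with
  | zero => rfl
  | succ n ih => rw [sgd, msgd, ih, Finset.smul_sum]

/-- Uniform weights on a batch of size `b` form a sampling vector, of covariance zero. -/
theorem isSampling_const {b : ℕ} {Ω : Type*} [MeasurableSpace Ω] (μ : Measure Ω)
    [IsProbabilityMeasure μ] :
    IsSampling μ b (fun (_ : ℕ) (_ : Ω) (_ : Fin b) => 1 / (b : ℝ)) where
  measurable _ := measurable_const
  memLp _ _ := memLp_const _
  mean _ _ := by simp
  cov _ := by
    ext r s
    simp
  indep := by
    rw [iIndepFun_iff_measure_inter_preimage_eq_mul]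
    intro S sets _
    by_cases hS : ∀ i ∈ S, (fun _ : Fin b => 1 / (b : ℝ)) ∈ sets i
    · have h1 : ∀ i ∈ S, (fun (_ : Ω) (_ : Fin b) => 1 / (b : ℝ)) ⁻¹' sets i = Set.univ :=
        fun i hi => Set.eq_univ_of_forall fun _ => hS i hi
      rw [Set.iInter₂_congr h1, Finset.prod_congr rfl fun i hi => by rw [h1 i hi]]
      simp
    · push Not at hS
      obtain ⟨i, hi, hni⟩ := hS
      have h1 : (fun (_ : Ω) (_ : Fin b) => 1 / (b : ℝ)) ⁻¹' sets i = ∅ :=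
        Set.eq_empty_of_forall_notMem fun _ => hni
      rw [Finset.prod_eq_zero hi (by rw [h1, measure_empty])]
      exact measure_mono_null (Set.biInter_subset_of_mem hi) (by rw [h1, measure_empty])

theorem ae_inner_sample_eq_zero {d B : ℕ} {Ω : Type*} [MeasurableSpace Ω] {μ : Measure Ω}
    {ν : Measure (Vec d × ℝ)} [IsProbabilityMeasure ν] {z : ℕ → Fin B → Ω → Vec d × ℝ}
    {R σ lam : ℝ} (h : Assumptions ν R σ lam) (hz : IsOnlineSample μ ν z)
    {k : Vec d} (hk : covOp ν k = 0) :
    ∀ᵐ ω ∂μ, ∀ n r, inner ℝ (z n r ω).1 k = (0 : ℝ) := by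
  refine ae_all_iff.2 fun n => ae_all_iff.2 fun r => ?_
  have := h.inner_ae_eq_zero hk
  rw [← hz.map_eq n r] at this
  exact ae_of_ae_map (hz.measurable n r).aemeasurable this

theorem Assumptions.inner_covOp_add_le {d : ℕ} {ν : Measure (Vec d × ℝ)}
    [IsProbabilityMeasure ν] {R σ lam : ℝ} (h : Assumptions ν R σ lam) (a c : Vec d) :
    inner ℝ (a + c) (covOp ν (a + c)) ≤
      2 * inner ℝ a (covOp ν a) + 2 * inner ℝ c (covOp ν c) := by
  have := h.inner_covOp_self_nonneg (a - c)
  simp only [map_sub, map_add, inner_add_left, inner_add_right, inner_sub_left,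
    inner_sub_right] at this ⊢
  linarith

section Rate

variable {d b B : ℕ} {Ω : Type*} [MeasurableSpace Ω] {μ : Measure Ω} [IsProbabilityMeasure μ]
  {ν : Measure (Vec d × ℝ)} [IsProbabilityMeasure ν]
  {z : ℕ → Fin B → Ω → Vec d × ℝ} {w : ℕ → Ω → Fin B → ℝ} {R σ lam η : ℝ}

/-- The rate for sampling vectors on batches of any size `B ≥ b`; the case `B = b` with uniform
weights is mini-batch SGD. -/
theorem msgd_rate (h : Assumptions ν R σ lam) (hb : 1 ≤ b) (hB : b ≤ B) (hη : 0 < η)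
    (hstep : η * ((R ^ 2 + ((b : ℝ) - 1) * lam) / b) < 2)
    (hz : IsOnlineSample μ ν z) (hw : IsSampling μ b w)
    (hzw : IndepFun (fun ω (k : ℕ × Fin B) => z k.1 k.2 ω) (fun ω n => w n ω) μ)
    (θ₀ : Vec d) (n : ℕ) :
    Integrable (fun ω => risk ν (average
      (msgd η θ₀ (fun k r => z k r ω) (fun k => w k ω)) n)) μ ∧
    ∫ ω, risk ν (average (msgd η θ₀ (fun k r => z k r ω) (fun k => w k ω)) n) ∂μ
        - risk ν (optimum ν) ≤
      4 * d * σ ^ 2 / (b * stepMargin b η R lam) / ((n : ℝ) + 1) +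
        4 * d * initialGap ν θ₀ / (η ^ 2 * stepMargin b η R lam) / ((n : ℝ) + 1) ^ 2 := by
  have hγ : 0 < stepMargin b η R lam := sub_pos.2 hstep
  have hb0 : (0 : ℝ) < b := by positivity
  set u₀ := θ₀ - optimum ν with hu₀
  -- `p` and `k` are the components of the initial error in the range and the kernel of `Σ`
  set p := covOp ν (pinvOp ν u₀) with hp
  set k := u₀ - p with hkdef
  have hk : covOp ν k = 0 := by rw [hkdef, map_sub, hp, covOp_covOp_pinvOp, sub_self]
  have hg : 0 ≤ initialGap ν θ₀ := by
    rw [initialGap_eq]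
    exact h.inner_covOp_self_nonneg _
  have hpg : ∀ v, inner ℝ v p ^ 2 ≤ initialGap ν θ₀ * inner ℝ v (covOp ν v) := fun v => by
    rw [initialGap_eq]
    exact h.inner_covOp_sq_le _ v
  set a : Ω → Vec d := fun ω => ∑ i ∈ Finset.range (n + 1), errorProc η 1 ν 0 z w i ω with ha
  set c : Ω → Vec d := fun ω => ∑ i ∈ Finset.range (n + 1), errorProc η 0 ν p z w i ω with hc
  have ham : MemLp a 2 μ := memLp_finsetSum _ fun i _ => memLp_errorProc h hz hw hzw i
  have hcm : MemLp c 2 μ := memLp_finsetSum _ fun i _ => memLp_errorProc h hz hw hzw i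
  set t : ℝ := 1 / ((n : ℝ) + 1) with ht
  have hn : (0 : ℝ) < (n : ℝ) + 1 := by positivity
  have hrisk : ∀ᵐ ω ∂μ, risk ν (average (msgd η θ₀ (fun k r => z k r ω) (fun k => w k ω)) n) =
      risk ν (optimum ν) + t ^ 2 / 2 * inner ℝ (a ω + c ω) (covOp ν (a ω + c ω)) := by
    filter_upwards [ae_inner_sample_eq_zero h hz hk] with ω hω
    have hsplit : average (msgd η θ₀ (fun k r => z k r ω) (fun k => w k ω)) n - optimum ν =
        k + t • (a ω + c ω) := by
      have h1 : ∀ i, msgd η θ₀ (fun k r => z k r ω) (fun k => w k ω) i - optimum ν =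
          k + (errorProc η 1 ν 0 z w i ω + errorProc η 0 ν p z w i ω) := fun i => by
        rw [msgd_sub_optimum, ← hu₀, ← sub_add_cancel u₀ p]
        exact errorSeq_add η ν k p _ _ hω i
      rw [average_sub, ← ht]
      simp only [h1, Finset.sum_add_distrib, Finset.sum_const, Finset.card_range]
      rw [smul_add, ← Nat.cast_smul_eq_nsmul ℝ, smul_smul]
      push_cast
      rw [ht, one_div_mul_cancel hn.ne', one_smul]
    have hz0 : ∀ v, inner ℝ k (covOp ν v) = (0 : ℝ) := fun v => by
      rw [h.inner_covOp_comm, hk, inner_zero_right]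
    rw [h.risk_eq, hsplit, map_add, hk, zero_add, inner_add_left, hz0, map_smul,
      real_inner_smul_left, real_inner_smul_right]
    ring
  have hi : Integrable (fun ω => t ^ 2 / 2 * inner ℝ (a ω + c ω) (covOp ν (a ω + c ω))) μ :=
    (integrable_inner_of_memLp_two (ham.add hcm)
      (memLp_linearMap_comp (covOp ν) (ham.add hcm))).const_mul _
  refine ⟨((integrable_const _).add hi).congr (hrisk.mono fun ω hω => hω.symm), ?_⟩
  have ia := integrable_inner_of_memLp_two ham (memLp_linearMap_comp (covOp ν) ham)
  have ic := integrable_inner_of_memLp_two hcm (memLp_linearMap_comp (covOp ν) hcm)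
  have hQ : ∫ ω, inner ℝ (a ω + c ω) (covOp ν (a ω + c ω)) ∂μ ≤
      2 * ∫ ω, inner ℝ (a ω) (covOp ν (a ω)) ∂μ + 2 * ∫ ω, inner ℝ (c ω) (covOp ν (c ω)) ∂μ := by
    rw [← integral_const_mul, ← integral_const_mul,
      ← integral_add (ia.const_mul 2) (ic.const_mul 2)]
    exact integral_mono (integrable_inner_of_memLp_two (ham.add hcm)
      (memLp_linearMap_comp (covOp ν) (ham.add hcm))) ((ia.const_mul 2).add (ic.const_mul 2))
      fun ω => h.inner_covOp_add_le _ _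
  have hA : ∫ ω, inner ℝ (a ω) (covOp ν (a ω)) ∂μ ≤ 4 / η *
      (((n + 1 : ℕ) : ℝ) * (d * (η * σ ^ 2 / (b * stepMargin b η R lam)))) :=
    (integral_inner_covOp_sum_le h hb hB hη hstep hz hw hzw (n + 1)).trans
      (mul_le_mul_of_nonneg_left
        (sum_integral_norm_sq_noisy_le h hb hB hη hstep hz hw hzw (n + 1)) (by positivity))
  have hC : ∫ ω, inner ℝ (c ω) (covOp ν (c ω)) ∂μ ≤ 4 / η *
      (d * (initialGap ν θ₀ / (η * stepMargin b η R lam))) :=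
    (integral_inner_covOp_sum_le h hb hB hη hstep hz hw hzw (n + 1)).trans
      (mul_le_mul_of_nonneg_left
        (sum_integral_norm_sq_noiseless_le h hb hB hη hstep hz hw hzw hg hpg (n + 1))
        (by positivity))
  rw [integral_congr_ae hrisk, integral_add (integrable_const _) hi, integral_const_mul,
    integral_const, probReal_univ, one_smul, add_sub_cancel_left]
  push_cast at hA
  calc t ^ 2 / 2 * ∫ ω, inner ℝ (a ω + c ω) (covOp ν (a ω + c ω)) ∂μ
      ≤ t ^ 2 / 2 * (2 * (4 / η *
          (((n : ℝ) + 1) * (d * (η * σ ^ 2 / (b * stepMargin b η R lam))))) +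
          2 * (4 / η * (d * (initialGap ν θ₀ / (η * stepMargin b η R lam))))) := by
        refine mul_le_mul_of_nonneg_left ?_ (by positivity)
        linarith
    _ = _ := by
        rw [ht]
        field_simp

end Rate

end OnlineLS

end

theorem theorem1 (d b : ℕ) (hb : 1 ≤ b) (η R σ lam : ℝ) (hη : 0 < η)
    (hstep : η * ((R ^ 2 + ((b : ℝ) - 1) * lam) / b) < 2) :
    ∃ C₁ : ℝ, ∃ C₂ : ℝ → ℝ,
      ∀ (ν : Measure (OnlineLS.Vec d × ℝ)) [IsProbabilityMeasure ν] (θ₀ : OnlineLS.Vec d),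
        OnlineLS.Assumptions ν R σ lam →
        -- large-batch MSGD
        (∀ (B : ℕ), b < B →
          ∀ (Ω : Type*) [MeasurableSpace Ω] (μ : Measure Ω) [IsProbabilityMeasure μ]
            (z : ℕ → Fin B → Ω → OnlineLS.Vec d × ℝ) (w : ℕ → Ω → Fin B → ℝ),
            OnlineLS.IsOnlineSample μ ν z →
            OnlineLS.IsSampling μ b w →
            IndepFun (fun ω (k : ℕ × Fin B) => z k.1 k.2 ω) (fun ω n => w n ω) μ →
            ∀ n : ℕ,
              Integrable (fun ω => OnlineLS.risk ν (OnlineLS.average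
                (OnlineLS.msgd η θ₀ (fun k r => z k r ω) (fun k => w k ω)) n)) μ ∧
              ∫ ω, OnlineLS.risk ν (OnlineLS.average
                  (OnlineLS.msgd η θ₀ (fun k r => z k r ω) (fun k => w k ω)) n) ∂μ
                - OnlineLS.risk ν (OnlineLS.optimum ν)
              ≤ C₁ / ((n : ℝ) + 1) + C₂ (OnlineLS.initialGap ν θ₀) / ((n : ℝ) + 1) ^ 2) ∧
        -- small-batch SGD
        (∀ (Ω : Type*) [MeasurableSpace Ω] (μ : Measure Ω) [IsProbabilityMeasure μ]
            (z : ℕ → Fin b → Ω → OnlineLS.Vec d × ℝ),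
            OnlineLS.IsOnlineSample μ ν z →
            ∀ n : ℕ,
              Integrable (fun ω => OnlineLS.risk ν (OnlineLS.average
                (OnlineLS.sgd η θ₀ (fun k r => z k r ω)) n)) μ ∧
              ∫ ω, OnlineLS.risk ν (OnlineLS.average
                  (OnlineLS.sgd η θ₀ (fun k r => z k r ω)) n) ∂μ
                - OnlineLS.risk ν (OnlineLS.optimum ν)
              ≤ C₁ / ((n : ℝ) + 1) + C₂ (OnlineLS.initialGap ν θ₀) / ((n : ℝ) + 1) ^ 2) := by
  refine ⟨4 * d * σ ^ 2 / (b * OnlineLS.stepMargin b η R lam),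
    fun g => 4 * d * g / (η ^ 2 * OnlineLS.stepMargin b η R lam), fun ν _ θ₀ h => ⟨?_, ?_⟩⟩
  · intro B hB Ω _ μ _ z w hz hw hzw n
    exact OnlineLS.msgd_rate h hb hB.le hη hstep hz hw hzw θ₀ n
  · intro Ω _ μ _ z hz n
    simp only [OnlineLS.sgd_eq_msgd]
    exact OnlineLS.msgd_rate h hb le_rfl hη hstep hz (OnlineLS.isSampling_const μ)
      (indepFun_const_right _ _) θ₀ n
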